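/- Setting. Euclidean space $\mathbb R^3$ is partitioned into the cubic cells $[x,x+1)\times[y,y+1)\times[z,z+1)$, $(x,y,z)\in\mathbb Z^3$; a region is a set $A$ of cells, and $A'$ denotes the set of cells that intersect the area of radius $1$ around $A$ (the union of the closed balls of radius $1$ centered on points of $A$). Let $K\subseteq\mathbb C$ be a finite extension of $\mathbb Q$ and let $\Sigma$, the state space of each cell, be the $K$-vector space with basis $e_1,\dots,e_n$ ($n\ge 1$), where $e_1=|q\rangle$ is the (pure) quiescent state. A configuration is a function from $\mathbb Z^3$ to $\{e_1,\dots,e_n\}$ equal to $e_1$ almost everywhere, and the global state space $\mathcal H$ is the $K$-vector space of formal linear combinations of configurations, with the hermitian form for which the configurations are orthonormal; so every global state is quiescent outside a finite region. Fix a computable enumeration of the cells; it presents configurations as sequences $e_{j_1,j_2,\dots}$, and $\otimes:\Sigma\times\mathcal H\to\mathcal H$ is the bilinear map with $e_i\otimes e_{j_1,j_2,\dots}=e_{i,j_1,j_2,\dots}$. The density matrix $\rho_\psi(A)$ of a region $A$ in the global state $\psi$ is the partial trace of $|\psi\rangle\langle\psi|$ over the complement of $A$. An indexing of a set is an injective map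 to $\mathbb N$ with decidable range. Theorem. There are indexings of $K$, $\Sigma$ and $\mathcal H$ for which all the operations of the structure $\langle K,\Sigma,\mathcal H,+,\times,+,.,+,.,\otimes\rangle$ (addition and multiplication of $K$, addition and scalar multiplication of $\Sigma$ and of $\mathcal H$, and $\otimes$) are computable, and relatively to which the following holds. Let $T$ be a real number and, for each time $t\in\mathbb R$, let $G(t):\mathcal H\to\mathcal H$ be the $K$-linear global evolution from time $t$ to time $t+T$. Assume (homogeneity of space) every $G(t)$ commutes with all translations by vectors of $\mathbb Z^3$; (homogeneity of time) $G(t)$ is independent of $t$; (bounded velocity of information) for every region $A$, every time $t$ and all $\psi,\varphi\in\mathcal H$, if $\rho_\psi(A')=\rho_\varphi(A')$ then $\rho_{G(t)\psi}(A)=\rho_{G(t)\varphi}(A)$; (unitarity) every $G(t)$ is surjective and preserves the hermitian form. Then for every history $\psi:\mathbb R\to\mathcal H$ with $\psi(t+T)=G(t)\psi(t)$ for all $t$, the map $k\mapsto\psi(kT)$ from $\mathbb N$ to $\mathcal H$, which maps $k$ to the global state at time $kT$, is computable. -/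

import Mathlib

namespace QuantumGandy

noncomputable section

/-! ### Space, cells and regions -/

/-- The three-dimensional euclidean space. -/
abbrev Space := EuclideanSpace ℝ (Fin 3)

/-- Cells are referenced by triples of integers; translations by integer vectors likewise. -/
abbrev Cell := ℤ × ℤ × ℤ

/-- The cubic cell `[x, x+1) × [y, y+1) × [z, z+1)`. -/
def cube (C : Cell) : Set Space :=
  {p | p 0 ∈ Set.Ico (C.1 : ℝ) (C.1 + 1) ∧ p 1 ∈ Set.Ico (C.2.1 : ℝ) (C.2.1 + 1) ∧
    p 2 ∈ Set.Ico (C.2.2 : ℝ) (C.2.2 + 1)}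

/-- The part of space occupied by a set of cells. -/
def regionSpace (A : Set Cell) : Set Space := ⋃ C ∈ A, cube C

/-- The area of radius `r` around `P`: the union of the closed spheres of radius `r` centered on
a point of `P`. -/
def area (r : ℝ) (P : Set Space) : Set Space := ⋃ p ∈ P, Metric.closedBall p r

/-- The region of radius `1` around the region `A`: all the cells that intersect the area of
radius `1` around `A`. -/
def around (A : Set Cell) : Set Cell := {C | (cube C ∩ area 1 (regionSpace A)).Nonempty}

/-- The index of a cell, a one-to-one correspondence between cells and natural numbers. -/
def cellIndex : Cell ≃ ℕ :=
  ((Equiv.intEquivNat.prodCongr (Equiv.intEquivNat.prodCongr Equiv.intEquivNat)).trans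
    ((Equiv.refl ℕ).prodCongr Nat.pairEquiv)).trans Nat.pairEquiv

/-! ### Configurations and the space `ℋ` -/

section

variable (K : IntermediateField ℚ ℂ) (n : ℕ) [NeZero n]

/-- Configurations of a set `A` of cells over the basis `{e₀, …, eₙ₋₁}` of the state space of a
cell, where `e₀ = |q⟩` is the quiescent state: functions from `A` to basis vectors that are equal
to `e₀` almost everywhere. -/
abbrev ConfigOn (A : Set Cell) := {C // C ∈ A} →₀ Fin n

/-- Configurations of the whole space. -/
abbrev Config := Cell →₀ Fin n

/-- The state space of a cell, the `K`-vector space with basis `e₀, …, eₙ₋₁`. -/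
abbrev CellState := Fin n → K

/-- The space `ℋ` of formal `K`-linear combinations of configurations. -/
abbrev Fock := Config n →₀ K

end

section

variable {K : IntermediateField ℚ ℂ} {n : ℕ} [NeZero n]

/-- The hermitian form on `ℋ` for which the configurations form an orthonormal basis. -/
def fockInner (ψ φ : Fock K n) : ℂ :=
  ψ.sum fun c a => star (a : ℂ) * (φ c : ℂ)

/-- The action on configurations of the translation by the integer vector `v`: the content of the
cell `C` is sent into the cell `C + v`. -/
def shiftConfig (v : Cell) (c : Config n) : Config n :=
  c.equivMapDomain (Equiv.addRight v)

/-- The action on `ℋ` of the translation by the integer vector `v`. -/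
def shift (v : Cell) : Fock K n →ₗ[K] Fock K n :=
  Finsupp.lmapDomain K K (shiftConfig v)

/-- The injection of cells that maps the cell of index `k` to the cell of index `k + 1`. -/
def nextCell : Cell ↪ Cell where
  toFun C := cellIndex.symm (cellIndex C + 1)
  inj' C D h := by simpa using h

/-- The configuration with sequence `i, j₀, j₁, …`, where `c` is the one with sequence
`j₀, j₁, …` (along the enumeration of cells by their index). -/
def consConfig (i : Fin n) (c : Config n) : Config n :=
  (c.embDomain nextCell).update (cellIndex.symm 0) i

/-- The bilinear operation `⊗` from `Σ × ℋ` to `ℋ` with `e_i ⊗ e_{j₀, j₁, …} = e_{i, j₀, j₁, …}`. -/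
def tensor (σ : CellState K n) (ψ : Fock K n) : Fock K n :=
  ∑ i, σ i • ψ.mapDomain (consConfig i)

/-! ### Density matrices -/

/-- The pure density matrix `|ψ⟩⟨ψ|`, in the basis of configurations. -/
def pureDensity (ψ : Fock K n) : Matrix (Config n) (Config n) ℂ :=
  fun c c' => (ψ c : ℂ) * star (ψ c' : ℂ)

open scoped Classical in
/-- The configuration of the whole space made of a configuration of `A` and one of its
complement. -/
def join (A : Set Cell) (a : ConfigOn n A) (d : {C // ¬ C ∈ A} →₀ Fin n) : Config n :=
  Finsupp.piecewise a d

/-- The partial trace over the complement of `A`. -/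
def partialTrace (A : Set Cell) (M : Matrix (Config n) (Config n) ℂ) :
    Matrix (ConfigOn n A) (ConfigOn n A) ℂ :=
  fun a a' => ∑ᶠ d : {C // ¬ C ∈ A} →₀ Fin n, M (join A a d) (join A a' d)

/-- The density matrix `ρ(A)` of the region `A` when the global state is `ψ`. -/
def regionDensity (A : Set Cell) (ψ : Fock K n) : Matrix (ConfigOn n A) (ConfigOn n A) ℂ :=
  partialTrace A (pureDensity ψ)

theorem join_injective (A : Set Cell) (a : ConfigOn n A) :
    Function.Injective (join A a) := by
  classical
  intro d d' h
  ext ⟨C, hC⟩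
  have := DFunLike.congr_fun h C
  simpa [join, hC] using congrArg Fin.val this

/-- The sums that define the density matrix of a region are finite. -/
theorem regionDensity_finite (A : Set Cell) (ψ : Fock K n) (a a' : ConfigOn n A) :
    (Function.support fun d => pureDensity ψ (join A a d) (join A a' d)).Finite := by
  refine (ψ.support.finite_toSet.preimage (join_injective A a).injOn).subset ?_
  intro d hd
  simp only [pureDensity, Function.mem_support] at hd
  simp only [Set.mem_preimage, Finset.mem_coe, Finsupp.mem_support_iff]
  intro h
  simp [h] at hd

/-! ### The hypotheses on the evolution

`G t` is the global evolution from time `t` to time `t + T`. -/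

/-- Homogeneity of space: the evolution commutes with all translations. -/
def HomogeneousSpace (G : ℝ → Fock K n →ₗ[K] Fock K n) : Prop :=
  ∀ (t : ℝ) (v : Cell), G t ∘ₗ shift v = shift v ∘ₗ G t

/-- Homogeneity of time: the evolution from `t` to `t + T` is independent of `t`. -/
def HomogeneousTime (G : ℝ → Fock K n →ₗ[K] Fock K n) : Prop :=
  ∀ s t : ℝ, G s = G t

/-- Bounded velocity of propagation of information: the density matrix of a region `A` at time
`t + T` depends only on the density matrix at time `t` of the region of radius `1` around `A`. -/
def BoundedVelocity (G : ℝ → Fock K n →ₗ[K] Fock K n) : Prop :=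
  ∀ (A : Set Cell) (t : ℝ) (ψ φ : Fock K n),
    regionDensity (around A) ψ = regionDensity (around A) φ →
      regionDensity A (G t ψ) = regionDensity A (G t φ)

/-- Unitarity: every `G t` is a surjective linear map that preserves the hermitian form. -/
def UnitaryEvolution (G : ℝ → Fock K n →ₗ[K] Fock K n) : Prop :=
  ∀ t : ℝ, Function.Surjective (G t) ∧
    ∀ ψ φ : Fock K n, fockInner (G t ψ) (G t φ) = fockInner ψ φ

end

/-! ### Indexings -/

/-- An indexing of a set: an injective numbering of its elements with decidable range. -/
structure Indexing (E : Type) where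
  code : E → ℕ
  injective : Function.Injective code
  decidable_range : ComputablePred fun m : ℕ => m ∈ Set.range code

/-- A binary operation is computable relatively to indexings of its domain and codomain. -/
def ComputableOp {E F H : Type} (iE : Indexing E) (iF : Indexing F) (iH : Indexing H)
    (f : E → F → H) : Prop :=
  ∃ g : ℕ → ℕ → ℕ, Computable₂ g ∧ ∀ x y, g (iE.code x) (iF.code y) = iH.code (f x y)

/-- Indexings of `K`, `Σ` and `ℋ` for which all the operations of the structure
`⟨K, Σ, ℋ, +, ×, +, ., +, ., ⊗⟩` are computable. -/
structure Admissible {K : IntermediateField ℚ ℂ} {n : ℕ} [NeZero n]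
    (iK : Indexing K) (iS : Indexing (CellState K n)) (iH : Indexing (Fock K n)) : Prop where
  add_K : ComputableOp iK iK iK fun a b => a + b
  mul_K : ComputableOp iK iK iK fun a b => a * b
  add_S : ComputableOp iS iS iS fun σ τ => σ + τ
  smul_S : ComputableOp iK iS iS fun a σ => a • σ
  add_H : ComputableOp iH iH iH fun ψ φ => ψ + φ
  smul_H : ComputableOp iK iH iH fun a ψ => a • ψ
  tensor_H : ComputableOp iS iH iH fun σ ψ => tensor σ ψ

end

end QuantumGandy

open QuantumGandy

namespace QuantumGandy

open Primrec

/-! A global state is a finite rational combination of products of an element of a `ℚ`-basis of `K`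
with a configuration, and a configuration is a finite association list. Equality and all the
operations are primitive recursive on such data; indexing an element by the least code of its
representatives gives admissible indexings. It remains to compute the evolution `U` on data;
iteration then gives the history.

A configuration is built from the quiescent one by resetting cells one at a time. So `U` of a
configuration is obtained from `U` of the quiescent configuration, a single vector, by applying the
conjugates `U * setOp C x * U⁻¹` (`op_single_config_cons`).

These conjugates are local. For a self-adjoint signed permutation `Z` of the states of a cell `D`,
the expectation of `U⁻¹ Z U` in `ψ` depends only on the density matrix of `around {D}`, by bounded
velocity. A reflection `R` of a cell `C` outside `around {D}` does not change that matrix, so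
polarization shows that `U⁻¹ Z U` commutes with `R` (`commute_conj_cellOp`). Resets are combinations
of products of reflections, hence the conjugate of a reset of `C` commutes with the resets of `D`
(`conjSetOp_setOp`).

Consequently such a conjugate acts on a configuration only through the content of a bounded
neighbourhood of `C`. By translation invariance its action is read from one finite table at the
origin (`exists_localTable`, `eval_localStep`), and finite tables are primitive recursive. -/

/-! ### Indexings from presentations -/

/-- A surjective numbering by a type of data for which equality of the represented elements is
primitive recursive. -/
structure IsPresentation {D E : Type} [Primcodable D] (rep : D → E) : Prop where
  surjective : Function.Surjective rep
  rel : PrimrecRel fun a b : D => rep a = rep b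

namespace IsPresentation

variable {D E : Type} [Primcodable D] {rep : D → E}

theorem exists_code (h : IsPresentation rep) (e : E) :
    ∃ m : ℕ, ∃ d ∈ (Encodable.decode m : Option D), rep d = e := by
  obtain ⟨d, rfl⟩ := h.surjective e
  exact ⟨Encodable.encode d, d, by simp, rfl⟩

open Classical in
/-- The least code of a representative. -/
noncomputable def code (h : IsPresentation rep) (e : E) : ℕ := Nat.find (h.exists_code e)

theorem code_spec (h : IsPresentation rep) (e : E) :
    ∃ d ∈ (Encodable.decode (h.code e) : Option D), rep d = e := by
  classical
  exact Nat.find_spec (h.exists_code e)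

theorem primrec_code_rel (h : IsPresentation rep) :
    PrimrecPred fun p : D × ℕ =>
      ∃ d ∈ (Encodable.decode p.2 : Option D), rep d = rep p.1 := by
  classical
  have : Primrec fun p : D × ℕ =>
      ((Encodable.decode p.2 : Option D).map fun d => decide (rep d = rep p.1)).getD false :=
    option_getD.comp (option_map (Primrec.decode.comp snd)
      (h.rel.decide.comp₂ Primrec₂.right (fst.comp₂ Primrec₂.left))) (Primrec.const false)
  refine PrimrecPred.of_eq (Primrec.eq.comp this (Primrec.const true)) fun p => ?_
  cases (Encodable.decode p.2 : Option D) <;> simp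

/-- The search for the least code terminates because the encoding of `d` itself qualifies. -/
theorem computable_code (h : IsPresentation rep) : Computable fun d => h.code (rep d) := by
  classical
  exact Computable.find (P := fun (d : D) m =>
    ∃ d' ∈ (Encodable.decode m : Option D), rep d' = rep d)
    h.primrec_code_rel.computablePred fun d => h.exists_code (rep d)

theorem code_injective (h : IsPresentation rep) : Function.Injective h.code := by
  intro e e' he
  obtain ⟨d, hd, rfl⟩ := h.code_spec e
  obtain ⟨d', hd', rfl⟩ := h.code_spec e'
  rw [he] at hd
  rw [Option.mem_unique hd hd']

/-- This form makes the range decidable: decode, then check that the number is the least code of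
what it represents. -/
theorem mem_range_code (h : IsPresentation rep) (m : ℕ) :
    m ∈ Set.range h.code ↔ ∃ d ∈ (Encodable.decode m : Option D), h.code (rep d) = m := by
  constructor
  · rintro ⟨e, rfl⟩
    obtain ⟨d, hd, he⟩ := h.code_spec e
    exact ⟨d, hd, by rw [he]⟩
  · rintro ⟨d, -, hd⟩
    exact ⟨_, hd⟩

/-- The indexing by least codes of representatives. -/
noncomputable def indexing (h : IsPresentation rep) : Indexing E where
  code := h.code
  injective := h.code_injective
  decidable_range := by
    classical
    have : Computable fun m : ℕ =>
        ((Encodable.decode m : Option D).map fun d => decide (h.code (rep d) = m)).getD false :=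
      Computable.option_getD (Computable.option_map Computable.decode
        ((Primrec.eq (α := ℕ)).decide.to_comp.comp₂
          (h.computable_code.comp₂ Primrec₂.right.to_comp) Primrec₂.left.to_comp))
        (Computable.const false)
    refine ComputablePred.of_eq (Computable.computablePred (p := fun m : ℕ =>
      ((Encodable.decode m : Option D).map fun d => decide (h.code (rep d) = m)).getD false = true)
      (by simpa using this)) fun m => ?_
    rw [h.mem_range_code]
    cases (Encodable.decode m : Option D) <;> simp

theorem computableOp {D₁ D₂ D₃ E₁ E₂ E₃ : Type} [Primcodable D₁] [Primcodable D₂]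
    [Primcodable D₃] {r₁ : D₁ → E₁} {r₂ : D₂ → E₂} {r₃ : D₃ → E₃} (h₁ : IsPresentation r₁)
    (h₂ : IsPresentation r₂) (h₃ : IsPresentation r₃) {f : E₁ → E₂ → E₃} {g : D₁ → D₂ → D₃}
    (hg : Primrec₂ g) (hfg : ∀ a b, r₃ (g a b) = f (r₁ a) (r₂ b)) :
    ComputableOp h₁.indexing h₂.indexing h₃.indexing f := by
  -- The value `0` on numbers that decode to nothing is irrelevant: codes always decode.
  refine ⟨fun m₁ m₂ => ((Encodable.decode (α := D₁) m₁).bind fun a =>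
    (Encodable.decode (α := D₂) m₂).map fun b => h₃.code (r₃ (g a b))).getD 0, ?_, fun x y => ?_⟩
  · refine Computable.option_getD (Computable.option_bind
      (Computable.decode.comp Computable.fst) ?_) (Computable.const 0)
    refine Computable.option_map (Computable.decode.comp (Computable.snd.comp Computable.fst)) ?_
    exact h₃.computable_code.comp (hg.to_comp.comp
      (Computable.snd.comp Computable.fst) Computable.snd)
  · obtain ⟨a, ha, rfl⟩ := h₁.code_spec x
    obtain ⟨b, hb, rfl⟩ := h₂.code_spec y
    rw [Option.mem_def] at ha hb
    simp only [indexing, ha, hb, hfg, Option.bind_some, Option.map_some, Option.getD_some]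

end IsPresentation

/-! ### Rational coefficients -/

/-- The triple `(p, q, r)` stands for the fraction `(p - q) / (r + 1)`. -/
abbrev Frac := ℕ × ℕ × ℕ

namespace Frac

/-- The rational number represented by a fraction. -/
def val (x : Frac) : ℚ := ((x.1 : ℚ) - x.2.1) / (x.2.2 + 1)

/-- Addition of fractions. -/
def add (x y : Frac) : Frac :=
  (x.1 * (y.2.2 + 1) + y.1 * (x.2.2 + 1), x.2.1 * (y.2.2 + 1) + y.2.1 * (x.2.2 + 1),
    x.2.2 * y.2.2 + x.2.2 + y.2.2)

/-- Multiplication of fractions. -/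
def mul (x y : Frac) : Frac :=
  (x.1 * y.1 + x.2.1 * y.2.1, x.1 * y.2.1 + x.2.1 * y.1, x.2.2 * y.2.2 + x.2.2 + y.2.2)

theorem val_add (x y : Frac) : (add x y).val = x.val + y.val := by
  have hx : (x.2.2 : ℚ) + 1 ≠ 0 := by positivity
  have hy : (y.2.2 : ℚ) + 1 ≠ 0 := by positivity
  -- Denominators are stored minus one, so `(r + 1)(s + 1)` is stored as `rs + r + s`.
  have : ((x.2.2 * y.2.2 + x.2.2 + y.2.2 : ℕ) : ℚ) + 1 = (x.2.2 + 1) * (y.2.2 + 1) := by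
    push_cast; ring
  simp only [val, add, this]
  push_cast
  field_simp
  ring

theorem val_mul (x y : Frac) : (mul x y).val = x.val * y.val := by
  have hx : (x.2.2 : ℚ) + 1 ≠ 0 := by positivity
  have hy : (y.2.2 : ℚ) + 1 ≠ 0 := by positivity
  have : ((x.2.2 * y.2.2 + x.2.2 + y.2.2 : ℕ) : ℚ) + 1 = (x.2.2 + 1) * (y.2.2 + 1) := by
    push_cast; ring
  simp only [val, mul, this]
  push_cast
  field_simp
  ring

theorem val_one : val (1, 0, 0) = 1 := by simp [val]

theorem val_zero : val (0, 0, 0) = 0 := by simp [val]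

/-- Cross-multiplication with the subtracted terms moved across, so that the test involves only
natural numbers. -/
theorem val_eq_val (x y : Frac) :
    x.val = y.val ↔
      x.1 * (y.2.2 + 1) + y.2.1 * (x.2.2 + 1) = y.1 * (x.2.2 + 1) + x.2.1 * (y.2.2 + 1) := by
  have hx : (x.2.2 : ℚ) + 1 ≠ 0 := by positivity
  have hy : (y.2.2 : ℚ) + 1 ≠ 0 := by positivity
  rw [val, val, div_eq_div_iff hx hy, ← Nat.cast_inj (R := ℚ)]
  push_cast
  constructor <;> intro h <;> linarith

theorem val_surjective : Function.Surjective val := by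
  intro q
  refine ⟨(q.num.toNat, (-q.num).toNat, q.den - 1), ?_⟩
  have h1 : ((q.num.toNat : ℚ) - ((-q.num).toNat : ℚ)) = q.num := by
    have := Int.toNat_sub_toNat_neg q.num
    exact_mod_cast this
  have h2 : ((q.den - 1 : ℕ) : ℚ) + 1 = q.den := by
    have := Nat.sub_add_cancel q.pos
    exact_mod_cast this
  rw [val, h1, h2, Rat.num_div_den]

theorem primrec_add : Primrec₂ add := by
  have x1 : Primrec fun p : Frac × Frac => p.1.1 := fst.comp fst
  have x2 : Primrec fun p : Frac × Frac => p.1.2.1 := fst.comp (snd.comp fst)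
  have x3 : Primrec fun p : Frac × Frac => p.1.2.2 := snd.comp (snd.comp fst)
  have y1 : Primrec fun p : Frac × Frac => p.2.1 := fst.comp snd
  have y2 : Primrec fun p : Frac × Frac => p.2.2.1 := fst.comp (snd.comp snd)
  have y3 : Primrec fun p : Frac × Frac => p.2.2.2 := snd.comp (snd.comp snd)
  have x3' := Primrec.succ.comp x3
  have y3' := Primrec.succ.comp y3
  exact (nat_add.comp (nat_mul.comp x1 y3') (nat_mul.comp y1 x3')).pair
    ((nat_add.comp (nat_mul.comp x2 y3') (nat_mul.comp y2 x3')).pair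
      (nat_add.comp (nat_add.comp (nat_mul.comp x3 y3) x3) y3))

theorem primrec_mul : Primrec₂ mul := by
  have x1 : Primrec fun p : Frac × Frac => p.1.1 := fst.comp fst
  have x2 : Primrec fun p : Frac × Frac => p.1.2.1 := fst.comp (snd.comp fst)
  have x3 : Primrec fun p : Frac × Frac => p.1.2.2 := snd.comp (snd.comp fst)
  have y1 : Primrec fun p : Frac × Frac => p.2.1 := fst.comp snd
  have y2 : Primrec fun p : Frac × Frac => p.2.2.1 := fst.comp (snd.comp snd)
  have y3 : Primrec fun p : Frac × Frac => p.2.2.2 := snd.comp (snd.comp snd)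
  exact (nat_add.comp (nat_mul.comp x1 y1) (nat_mul.comp x2 y2)).pair
    ((nat_add.comp (nat_mul.comp x1 y2) (nat_mul.comp x2 y1)).pair
      (nat_add.comp (nat_add.comp (nat_mul.comp x3 y3) x3) y3))

theorem primrec_val_eq : PrimrecRel fun x y : Frac => x.val = y.val := by
  have x1 : Primrec fun p : Frac × Frac => p.1.1 := fst.comp fst
  have x2 : Primrec fun p : Frac × Frac => p.1.2.1 := fst.comp (snd.comp fst)
  have x3 : Primrec fun p : Frac × Frac => p.1.2.2 := snd.comp (snd.comp fst)
  have y1 : Primrec fun p : Frac × Frac => p.2.1 := fst.comp snd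
  have y2 : Primrec fun p : Frac × Frac => p.2.2.1 := fst.comp (snd.comp snd)
  have y3 : Primrec fun p : Frac × Frac => p.2.2.2 := snd.comp (snd.comp snd)
  have x3' := Primrec.succ.comp x3
  have y3' := Primrec.succ.comp y3
  exact PrimrecPred.of_eq (Primrec.eq.comp
    (nat_add.comp (nat_mul.comp x1 y3') (nat_mul.comp y2 x3'))
    (nat_add.comp (nat_mul.comp y1 x3') (nat_mul.comp x2 y3'))) fun p => (val_eq_val p.1 p.2).symm

end Frac


/-! ### Formal rational combinations -/

/-- Formal combinations of indices with coefficients represented by fractions. -/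
abbrev FormalSum (I : Type) := List (I × Frac)

namespace FormalSum

section

variable {I J L E F H : Type} [AddCommGroup E] [Module ℚ E] [AddCommGroup F] [Module ℚ F]
  [AddCommGroup H] [Module ℚ H]

/-- The value of a formal combination for given values of the indices. -/
def eval (v : I → E) (l : FormalSum I) : E := (l.map fun t => t.2.val • v t.1).sum

/-- Substitution of formal combinations for indices. -/
def bind (f : I → FormalSum L) (l : FormalSum I) : FormalSum L :=
  l.flatMap fun s => (f s.1).map fun u => (u.1, s.2.mul u.2)

@[simp]
theorem eval_nil (v : I → E) : eval v [] = 0 := rfl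

@[simp]
theorem eval_cons (v : I → E) (t : I × Frac) (l : FormalSum I) :
    eval v (t :: l) = t.2.val • v t.1 + eval v l := by
  simp [eval]

@[simp]
theorem eval_append (v : I → E) (l l' : FormalSum I) :
    eval v (l ++ l') = eval v l + eval v l' := by
  simp [eval]

theorem eval_map_mul (v : I → E) (q : Frac) (l : FormalSum I) :
    eval v (l.map fun u => (u.1, q.mul u.2)) = q.val • eval v l := by
  induction l with
  | nil => simp
  | cons t l ih => simp [ih, Frac.val_mul, smul_add, mul_smul]

theorem eval_map (v : I → E) (w : L → E) (f : I → L) (hf : ∀ i, w (f i) = v i)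
    (l : FormalSum I) : eval w (l.map fun u => (f u.1, u.2)) = eval v l := by
  induction l with
  | nil => simp
  | cons t l ih => simp [ih, hf]

/-- A linear map is computed on data as soon as it is computed on indices; `eval_bind₂` does the
same for bilinear maps. -/
theorem eval_bind (v : I → E) (w : L → H) (B : E →ₗ[ℚ] H) (f : I → FormalSum L)
    (hf : ∀ i, eval w (f i) = B (v i)) (l : FormalSum I) :
    eval w (bind f l) = B (eval v l) := by
  induction l with
  | nil => simp [bind]
  | cons t l ih =>
    have : bind f (t :: l) = ((f t.1).map fun u => (u.1, t.2.mul u.2)) ++ bind f l := by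
      simp [bind]
    rw [this, eval_append, eval_map_mul, ih, hf, eval_cons, map_add, map_smul]

theorem eval_bind₂ (v : I → E) (v' : J → F) (w : L → H) (B : E →ₗ[ℚ] F →ₗ[ℚ] H)
    (f : I → J → FormalSum L) (hf : ∀ i j, eval w (f i j) = B (v i) (v' j)) (l : FormalSum I)
    (l' : FormalSum J) :
    eval w (bind (fun i => bind (f i) l') l) = B (eval v l) (eval v' l') := by
  refine eval_bind v w (B.flip (eval v' l')) _ (fun i => ?_) l
  exact eval_bind v' w (B (v i)) _ (hf i) l'

theorem map_eval (v : I → E) (B : E →ₗ[ℚ] H) (l : FormalSum I) :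
    B (eval v l) = eval (fun i => B (v i)) l := by
  induction l with
  | nil => simp
  | cons t l ih => simp [ih]

/-- The map `π` allows several indices for one basis vector, as with association lists of the same
configuration. -/
theorem eval_surjective {ι : Type} (w : Module.Basis ι ℚ E) {π : I → ι}
    (hπ : Function.Surjective π) : Function.Surjective (eval fun i => w (π i)) := by
  intro x
  refine Submodule.span_induction (p := fun x _ => ∃ l, eval (fun i => w (π i)) l = x)
    ?_ ⟨[], rfl⟩ ?_ ?_ (w.span_eq.symm ▸ Submodule.mem_top : x ∈ Submodule.span ℚ (Set.range w))
  · rintro _ ⟨j, rfl⟩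
    obtain ⟨i, rfl⟩ := hπ j
    exact ⟨[(i, (1, 0, 0))], by simp [Frac.val_one]⟩
  · rintro _ _ - - ⟨l, rfl⟩ ⟨l', rfl⟩
    exact ⟨l ++ l', by simp⟩
  · rintro q _ - ⟨l, rfl⟩
    obtain ⟨r, rfl⟩ := Frac.val_surjective q
    exact ⟨_, eval_map_mul _ r l⟩

open Classical in
/-- The total coefficient of the index `i`, where indices with the same value by `π` are
identified. -/
noncomputable def coeff {ι : Type} (π : I → ι) (l : FormalSum I) (i : I) : Frac :=
  l.foldr (fun t acc => if π t.1 = π i then t.2.add acc else acc) (0, 0, 0)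

theorem val_coeff {ι : Type} (w : Module.Basis ι ℚ E) (π : I → ι) (l : FormalSum I) (i : I) :
    (coeff π l i).val = w.repr (eval (fun i => w (π i)) l) (π i) := by
  classical
  induction l with
  | nil => simp [coeff, Frac.val_zero]
  | cons t l ih =>
    have : coeff π (t :: l) i =
      if π t.1 = π i then t.2.add (coeff π l i) else coeff π l i := rfl
    rw [this]
    by_cases h : π t.1 = π i
    · simp [h, Frac.val_add, ih]
    · simp [h, ih]

theorem repr_eval_eq_zero {ι : Type} (w : Module.Basis ι ℚ E) (π : I → ι) (l : FormalSum I)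
    (j : ι) (hj : ∀ t ∈ l, π t.1 ≠ j) : w.repr (eval (fun i => w (π i)) l) j = 0 := by
  induction l with
  | nil => simp
  | cons t l ih =>
    have h1 := hj t (by simp)
    have h2 := ih fun t ht => hj t (by simp [ht])
    simp [h1, h2]

/-- Coordinates at basis vectors that occur in neither list vanish on both sides, so finitely many
comparisons decide equality. -/
theorem eval_eq_eval_iff {ι : Type} (w : Module.Basis ι ℚ E) (π : I → ι) (l l' : FormalSum I) :
    eval (fun i => w (π i)) l = eval (fun i => w (π i)) l' ↔
      ∀ t ∈ l ++ l', (coeff π l t.1).val = (coeff π l' t.1).val := by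
  constructor
  · intro h t _
    rw [val_coeff w, val_coeff w, h]
  · intro h
    refine w.repr.injective (Finsupp.ext fun j => ?_)
    by_cases hj : ∃ t ∈ l ++ l', π t.1 = j
    · obtain ⟨t, ht, rfl⟩ := hj
      rw [← val_coeff w, ← val_coeff w, h t ht]
    · push Not at hj
      rw [repr_eval_eq_zero w π l j fun t ht => hj t (by simp [ht]),
        repr_eval_eq_zero w π l' j fun t ht => hj t (by simp [ht])]

end

section

variable {α I J L : Type} [Primcodable α] [Primcodable I] [Primcodable J] [Primcodable L]

theorem primrec_bind {f : α → I → FormalSum L} {l : α → FormalSum I} (hf : Primrec₂ f)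
    (hl : Primrec l) : Primrec fun a => bind (f a) (l a) := by
  refine list_flatMap hl (list_map (hf.comp fst (fst.comp snd)) ?_)
  exact (fst.comp snd).pair (Frac.primrec_mul.comp (snd.comp (snd.comp fst)) (snd.comp snd))

theorem primrec_bind₂ {f : I → J → FormalSum L} (hf : Primrec₂ f) :
    Primrec₂ fun (l : FormalSum I) (l' : FormalSum J) => bind (fun i => bind (f i) l') l :=
  primrec_bind (f := fun (p : FormalSum I × FormalSum J) i => bind (f i) p.2)
    (primrec_bind (f := fun (p : (FormalSum I × FormalSum J) × I) j => f p.2 j)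
      (hf.comp₂ (snd.comp₂ Primrec₂.left) Primrec₂.right) (snd.comp fst)) fst

theorem primrec_coeff {ι : Type} {π : I → ι} (hπ : PrimrecRel fun i j => π i = π j) :
    Primrec₂ (coeff π) := by
  classical
  refine list_foldr (f := fun p : FormalSum I × I => p.1) (g := fun _ => ((0, 0, 0) : Frac))
    (h := fun p s => if π s.1.1 = π p.2 then s.1.2.add s.2 else s.2) fst (Primrec.const _) ?_
  refine ite (hπ.comp (fst.comp (fst.comp snd)) (snd.comp fst)) ?_ (snd.comp snd)
  exact Frac.primrec_add.comp (snd.comp (fst.comp snd)) (snd.comp snd)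

theorem isPresentation_eval {ι E : Type} [AddCommGroup E] [Module ℚ E]
    (w : Module.Basis ι ℚ E) {π : I → ι} (hs : Function.Surjective π)
    (hπ : PrimrecRel fun i j => π i = π j) : IsPresentation (eval fun i => w (π i)) where
  surjective := eval_surjective w hs
  rel := by
    have hR : PrimrecRel fun (t : I × Frac) (p : FormalSum I × FormalSum I) =>
        (coeff π p.1 t.1).val = (coeff π p.2 t.1).val :=
      Frac.primrec_val_eq.comp
        ((primrec_coeff hπ).comp (fst.comp snd) (fst.comp fst))
        ((primrec_coeff hπ).comp (snd.comp snd) (fst.comp fst))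
    refine PrimrecPred.of_eq (hR.forall_mem_list.comp
      (list_append.comp fst snd) Primrec.id) fun p => ?_
    exact (eval_eq_eval_iff w π p.1 p.2).symm

end

end FormalSum


/-! ### Arithmetic of cells -/

theorem cellIndex_eq_encode : ⇑cellIndex = (Encodable.encode : Cell → ℕ) := by
  funext C
  rfl

theorem primrec_cellIndex : Primrec cellIndex := by
  rw [cellIndex_eq_encode]
  exact Primrec.encode

theorem primrec_cellIndex_symm : Primrec cellIndex.symm := by
  refine (Primrec.ofNat Cell).of_eq fun m => ?_
  rw [Equiv.eq_symm_apply, cellIndex_eq_encode, Denumerable.encode_ofNat]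

theorem primrec_nextCell : Primrec nextCell :=
  primrec_cellIndex_symm.comp (Primrec.succ.comp primrec_cellIndex)

/-- Nonnegative integers have even codes and negative ones odd codes; integer arithmetic below reads
the sign from the parity. -/
theorem encode_int_natCast (k : ℕ) : Encodable.encode (k : ℤ) = 2 * k := by
  change Nat.bit false k = _
  simp

theorem encode_int_negSucc (k : ℕ) : Encodable.encode (Int.negSucc k) = 2 * k + 1 := by
  change Equiv.intEquivNat (Int.negSucc k) = _
  simp [Equiv.intEquivNat, Equiv.intEquivNatSumNat, Equiv.natSumNatEquivNat]

theorem primrec_int_toNat : Primrec Int.toNat := by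
  refine (Primrec.ite (PrimrecPred.comp (p := fun m : ℕ => m % 2 = 0)
    (Primrec.eq.comp (nat_mod.comp Primrec.id (.const 2)) (.const 0)) (Primrec.encode (α := ℤ)))
    (nat_div.comp Primrec.encode (.const 2)) (.const 0)).of_eq fun a => ?_
  obtain k | k := a
  · rw [Int.ofNat_eq_natCast, encode_int_natCast]
    simp
  · rw [encode_int_negSucc, if_neg (by omega), Int.toNat_negSucc]

theorem primrec_int_toNat_neg : Primrec fun a : ℤ => (-a).toNat := by
  refine (Primrec.ite (PrimrecPred.comp (p := fun m : ℕ => m % 2 = 0)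
    (Primrec.eq.comp (nat_mod.comp Primrec.id (.const 2)) (.const 0)) (Primrec.encode (α := ℤ)))
    (.const 0) (Primrec.succ.comp (nat_div.comp Primrec.encode (.const 2)))).of_eq fun a => ?_
  obtain k | k := a
  · rw [Int.ofNat_eq_natCast, encode_int_natCast]
    simp
  · rw [encode_int_negSucc, if_neg (by omega), Int.neg_negSucc]
    simp
    omega

theorem primrec_int_subNat : Primrec₂ fun a b : ℕ => (a : ℤ) - b := by
  rw [← Primrec₂.encode_iff]
  -- A negative difference `-(k + 1)` has code `2k + 1 = 2(k + 1) - 1`.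
  refine (Primrec.ite (nat_le.comp snd fst) (nat_double.comp (nat_sub.comp fst snd))
    (nat_sub.comp (nat_double.comp (nat_sub.comp snd fst)) (.const 1))).of_eq fun p => ?_
  change _ = Encodable.encode ((p.1 : ℤ) - p.2)
  split_ifs with h
  · rw [← encode_int_natCast, Nat.cast_sub h]
  · obtain ⟨k, hk⟩ := Nat.exists_eq_add_of_lt (not_le.mp h)
    have h1 : (p.1 : ℤ) - p.2 = Int.negSucc k := by
      rw [hk, Int.negSucc_eq]; push_cast; ring
    rw [h1, encode_int_negSucc]
    omega

/-- Positive and negative parts are added separately in `ℕ`, then subtracted. -/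
theorem primrec_int_add : Primrec₂ fun a b : ℤ => a + b := by
  have hpos := primrec_int_toNat
  have hneg := primrec_int_toNat_neg
  have hsub := primrec_int_subNat
  refine (hsub.comp₂ (nat_add.comp₂ (hpos.comp₂ Primrec₂.left) (hpos.comp₂ Primrec₂.right))
    (nat_add.comp₂ (hneg.comp₂ Primrec₂.left) (hneg.comp₂ Primrec₂.right))).of_eq fun a b => ?_
  have ha := Int.toNat_sub_toNat_neg a
  have hb := Int.toNat_sub_toNat_neg b
  push_cast
  omega

theorem primrec_cell_add : Primrec₂ fun C D : Cell => C + D :=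
  (primrec_int_add.comp (fst.comp fst) (fst.comp snd)).pair
    ((primrec_int_add.comp (fst.comp (snd.comp fst)) (fst.comp (snd.comp snd))).pair
      (primrec_int_add.comp (snd.comp (snd.comp fst)) (snd.comp (snd.comp snd))))

/-! ### Representation of configurations by association lists -/

section

variable {n : ℕ} [NeZero n]

/-- Association lists that represent configurations; the first occurrence of a cell prevails. -/
abbrev CellList (n : ℕ) := List (Cell × Fin n)

/-- The configuration represented by an association list. -/
noncomputable def config (l : CellList n) : Config n :=
  l.foldr (fun t c => c.update t.1 t.2) 0

@[simp]
theorem config_nil : config ([] : CellList n) = 0 := rfl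

@[simp]
theorem config_cons (t : Cell × Fin n) (l : CellList n) :
    config (t :: l) = (config l).update t.1 t.2 := rfl

theorem config_apply (l : CellList n) (C : Cell) :
    config l C = l.foldr (fun t x => if t.1 = C then t.2 else x) 0 := by
  induction l with
  | nil => rfl
  | cons t l ih =>
    rw [config_cons, Finsupp.coe_update, Function.update_apply, ih, List.foldr_cons]
    simp only [eq_comm]

theorem primrec_config_apply : Primrec₂ fun (l : CellList n) (C : Cell) => config l C := by
  refine Primrec₂.of_eq ?_ fun l C => (config_apply l C).symm
  refine list_foldr (f := fun p : CellList n × Cell => p.1) (g := fun _ => (0 : Fin n))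
    (h := fun p s => if s.1.1 = p.2 then s.1.2 else s.2) fst (Primrec.const _) ?_
  exact ite (Primrec.eq.comp (fst.comp (fst.comp snd)) (snd.comp fst))
    (snd.comp (fst.comp snd)) (snd.comp snd)

theorem config_apply_of_notMem (l : CellList n) (C : Cell) (h : ∀ t ∈ l, t.1 ≠ C) :
    config l C = 0 := by
  induction l with
  | nil => rfl
  | cons t l ih =>
    rw [config_cons, Finsupp.coe_update, Function.update_of_ne (h t (by simp)).symm,
      ih fun t ht => h t (by simp [ht])]

theorem config_eq_iff (l l' : CellList n) :
    config l = config l' ↔ ∀ t ∈ l ++ l', config l t.1 = config l' t.1 := by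
  refine ⟨fun h t _ => by rw [h], fun h => Finsupp.ext fun C => ?_⟩
  by_cases hC : ∃ t ∈ l ++ l', t.1 = C
  · obtain ⟨t, ht, rfl⟩ := hC
    exact h t ht
  · push Not at hC
    rw [config_apply_of_notMem l C fun t ht => hC t (by simp [ht]),
      config_apply_of_notMem l' C fun t ht => hC t (by simp [ht])]

theorem primrec_config_eq : PrimrecRel fun l l' : CellList n => config l = config l' := by
  have hR : PrimrecRel fun (t : Cell × Fin n) (p : CellList n × CellList n) =>
      config p.1 t.1 = config p.2 t.1 :=
    Primrec.eq.comp (primrec_config_apply.comp (fst.comp snd) (fst.comp fst))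
      (primrec_config_apply.comp (snd.comp snd) (fst.comp fst))
  refine PrimrecPred.of_eq (hR.forall_mem_list.comp
    (list_append.comp fst snd) Primrec.id) fun p => ?_
  exact (config_eq_iff p.1 p.2).symm

theorem config_map_graph (c : Cell → Fin n) (L : List Cell) {C : Cell} (hC : C ∈ L) :
    config (L.map fun C => (C, c C)) C = c C := by
  induction L with
  | nil => simp at hC
  | cons D L ih =>
    by_cases hD : C = D
    · subst hD
      simp
    · rw [List.map_cons, config_cons, Finsupp.coe_update, Function.update_of_ne hD]
      exact ih (by simpa [hD] using hC)

theorem config_surjective : Function.Surjective (config : CellList n → Config n) := by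
  intro c
  refine ⟨c.support.toList.map fun C => (C, c C), Finsupp.ext fun C => ?_⟩
  by_cases hC : c C = 0
  · rw [config_apply_of_notMem, hC]
    intro t ht
    simp only [List.mem_map, Finset.mem_toList, Finsupp.mem_support_iff] at ht
    obtain ⟨D, hD, rfl⟩ := ht
    rintro rfl
    exact hD hC
  · exact config_map_graph c _ (by simpa using hC)

theorem consConfig_config (i : Fin n) (l : CellList n) :
    consConfig i (config l) =
      config ((cellIndex.symm 0, i) :: l.map fun t => (nextCell t.1, t.2)) := by
  rw [consConfig, config_cons]
  congr 1
  induction l with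
  | nil => simp
  | cons t l ih =>
    rw [List.map_cons, config_cons, config_cons, ← ih]
    ext C
    by_cases hC : C ∈ Set.range nextCell
    · obtain ⟨D, rfl⟩ := hC
      rw [Finsupp.embDomain_apply_self, Finsupp.coe_update, Finsupp.coe_update]
      by_cases hD : D = t.1
      · simp [hD]
      · rw [Function.update_of_ne hD, Function.update_of_ne (nextCell.injective.ne hD),
          Finsupp.embDomain_apply_self]
    · rw [Finsupp.embDomain_of_notMem_range _ _ _ hC, Finsupp.coe_update,
        Function.update_of_ne, Finsupp.embDomain_of_notMem_range _ _ _ hC]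
      rintro rfl
      exact hC ⟨_, rfl⟩

end


/-! ### Admissible indexings -/

section

variable {K : IntermediateField ℚ ℂ} {n : ℕ} [NeZero n] {d : ℕ}

theorem isPresentation_scalars (b : Module.Basis (Fin d) ℚ K) :
    IsPresentation (FormalSum.eval fun i => b i) :=
  FormalSum.isPresentation_eval b (π := id) Function.surjective_id Primrec.eq

omit [NeZero n] in
theorem isPresentation_cellState (b : Module.Basis (Fin d) ℚ K) :
    IsPresentation (FormalSum.eval fun p : Fin d × Fin n =>
      b p.1 • (Pi.single p.2 1 : CellState K n)) := by
  have := FormalSum.isPresentation_eval (b.smulTower (Pi.basisFun K (Fin n))) (π := id)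
    Function.surjective_id Primrec.eq
  simpa using this

/-- The global states represented by formal combinations of scalars and configurations. -/
noncomputable def fockVector (b : Module.Basis (Fin d) ℚ K) (p : Fin d × CellList n) :
    Fock K n :=
  b p.1 • Finsupp.single (config p.2) 1

/-- Products of the elements of `b` with configurations form a `ℚ`-basis of `ℋ`; equality of the
configurations of two association lists is decidable. -/
theorem isPresentation_fock (b : Module.Basis (Fin d) ℚ K) :
    IsPresentation (FormalSum.eval (fockVector (n := n) b)) := by
  have h1 : PrimrecRel fun p q : Fin d × CellList n =>
      Prod.map id config p = Prod.map id config q := by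
    refine PrimrecPred.of_eq (PrimrecPred.and
      (Primrec.eq.comp (fst.comp fst) (fst.comp snd))
      (primrec_config_eq.comp (snd.comp fst) (snd.comp snd))) fun p => ?_
    simp [Prod.ext_iff]
  have := FormalSum.isPresentation_eval (b.smulTower (Finsupp.basisSingleOne (R := K)))
    (π := Prod.map id config) (Function.surjective_id.prodMap config_surjective) h1
  have h2 : fockVector (n := n) b = fun p =>
      b.smulTower (Finsupp.basisSingleOne (R := K)) (Prod.map id config p) := by
    funext p
    rw [Module.Basis.smulTower_apply]
    simp [fockVector]
  rw [h2]
  exact this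

/-- The structure constants of `K` in the basis `b`. -/
noncomputable def structureConst (b : Module.Basis (Fin d) ℚ K) (i j : Fin d) :
    FormalSum (Fin d) :=
  ((isPresentation_scalars b).surjective (b i * b j)).choose

theorem eval_structureConst (b : Module.Basis (Fin d) ℚ K) (i j : Fin d) :
    FormalSum.eval (fun i => b i) (structureConst b i j) = b i * b j :=
  ((isPresentation_scalars b).surjective (b i * b j)).choose_spec

/-- The constants are chosen non-effectively, but there are finitely many of them. -/
theorem primrec_structureConst (b : Module.Basis (Fin d) ℚ K) :
    Primrec₂ (structureConst b) :=
  Primrec.dom_finite (fun p : Fin d × Fin d => structureConst b p.1 p.2)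

/-- The formal combination that represents the product of `b i`, `b j` and a vector of index
`x`. -/
noncomputable def scaledIndex {X : Type} (b : Module.Basis (Fin d) ℚ K) (i j : Fin d) (x : X) :
    FormalSum (Fin d × X) :=
  (structureConst b i j).map fun u => ((u.1, x), u.2)

theorem eval_scaledIndex {X E : Type} [AddCommGroup E] [Module ℚ E] [Module K E]
    [IsScalarTower ℚ K E] (b : Module.Basis (Fin d) ℚ K) (c : X → E) (i j : Fin d) (x : X) :
    FormalSum.eval (fun p : Fin d × X => b p.1 • c p.2) (scaledIndex b i j x) =
      (b i * b j) • c x := by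
  have h := FormalSum.map_eval (fun i => b i)
    ((LinearMap.toSpanSingleton K E (c x)).restrictScalars ℚ) (structureConst b i j)
  rw [eval_structureConst] at h
  rw [scaledIndex, FormalSum.eval_map (fun k => b k • c x) _ (fun k => (k, x)) fun _ => rfl]
  simpa using h.symm

theorem primrec_scaledIndex {α X : Type} [Primcodable α] [Primcodable X]
    (b : Module.Basis (Fin d) ℚ K) {f g : α → Fin d} {h : α → X} (hf : Primrec f)
    (hg : Primrec g) (hh : Primrec h) : Primrec fun a => scaledIndex b (f a) (g a) (h a) :=
  list_map ((primrec_structureConst b).comp hf hg)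
    (((fst.comp snd).pair (hh.comp fst)).pair (snd.comp snd))

/-- Scalar multiplication as a rational bilinear map. -/
noncomputable def smulBilin (K : IntermediateField ℚ ℂ) (E : Type) [AddCommGroup E] [Module ℚ E]
    [Module K E] [IsScalarTower ℚ K E] : K →ₗ[ℚ] E →ₗ[ℚ] E :=
  LinearMap.mk₂ ℚ (fun a x => a • x) (fun a b x => add_smul a b x)
    (fun q a x => smul_assoc q a x) (fun a x y => smul_add a x y)
    (fun q a x => by
      rw [← algebraMap_smul K q x, smul_smul, mul_comm, ← smul_smul, algebraMap_smul])

/-- The operation `⊗` as a rational bilinear map. -/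
noncomputable def tensorBilin (K : IntermediateField ℚ ℂ) (n : ℕ) [NeZero n] :
    CellState K n →ₗ[ℚ] Fock K n →ₗ[ℚ] Fock K n :=
  LinearMap.mk₂ ℚ tensor
    (fun σ τ ψ => by simp [tensor, add_smul, Finset.sum_add_distrib])
    (fun q σ ψ => by simp [tensor, Finset.smul_sum])
    (fun σ ψ φ => by simp [tensor, Finsupp.mapDomain_add, Finset.sum_add_distrib])
    (fun q σ ψ => by
      simp only [tensor, Finset.smul_sum, Finsupp.mapDomain_smul]
      exact Finset.sum_congr rfl fun i _ => ((smulBilin K (Fock K n)) (σ i)).map_smul q _)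

theorem tensor_single (i j : K) (a : Fin n) (c : Config n) :
    tensor (i • (Pi.single a 1 : CellState K n)) (j • Finsupp.single c 1) =
      (i * j) • (Finsupp.single (consConfig a c) 1 : Fock K n) := by
  rw [tensor, Finset.sum_eq_single a]
  · simp [Finsupp.mapDomain_single]
  · intro x _ hx
    simp [hx]
  · simp

theorem computableOp_smul {X E : Type} [Primcodable X] [AddCommGroup E] [Module ℚ E] [Module K E]
    [IsScalarTower ℚ K E] (b : Module.Basis (Fin d) ℚ K) (c : X → E)
    (h : IsPresentation (FormalSum.eval fun p : Fin d × X => b p.1 • c p.2)) :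
    ComputableOp (isPresentation_scalars b).indexing h.indexing h.indexing
      fun (a : K) x => a • x :=
  IsPresentation.computableOp _ _ _
    (FormalSum.primrec_bind₂ (f := fun i (p : Fin d × X) => scaledIndex b i p.1 p.2)
      (primrec_scaledIndex b fst (fst.comp snd) (snd.comp snd)))
    (FormalSum.eval_bind₂ _ _ _ (smulBilin K E) _ fun _ _ =>
      (eval_scaledIndex b c _ _ _).trans (mul_smul _ _ _))

theorem computableOp_tensor (b : Module.Basis (Fin d) ℚ K) :
    ComputableOp (isPresentation_cellState (n := n) b).indexing
      (isPresentation_fock (n := n) b).indexing (isPresentation_fock (n := n) b).indexing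
      tensor := by
  refine IsPresentation.computableOp _ _ _
    (FormalSum.primrec_bind₂ (f := fun (p : Fin d × Fin n) (q : Fin d × CellList n) =>
      scaledIndex b p.1 q.1 ((cellIndex.symm 0, p.2) :: q.2.map fun t => (nextCell t.1, t.2)))
      (primrec_scaledIndex b (fst.comp fst) (fst.comp snd) ?_))
    (FormalSum.eval_bind₂ _ _ _ (tensorBilin K n) _ fun p q => ?_)
  · exact list_cons.comp ((Primrec.const _).pair (snd.comp fst)) (list_map (snd.comp snd)
      ((primrec_nextCell.comp (fst.comp snd)).pair (snd.comp snd)))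
  · refine (eval_scaledIndex b
      (fun l => (Finsupp.single (config l) 1 : Fock K n)) _ _ _).trans ?_
    rw [← consConfig_config]
    exact (tensor_single _ _ _ _).symm

theorem computableOp_add {I E : Type} [Primcodable I] [AddCommGroup E] [Module ℚ E]
    {v : I → E} (h : IsPresentation (FormalSum.eval v)) :
    ComputableOp h.indexing h.indexing h.indexing fun x y => x + y :=
  IsPresentation.computableOp _ _ _ list_append fun _ _ => FormalSum.eval_append _ _ _

theorem computableOp_mul (b : Module.Basis (Fin d) ℚ K) :
    ComputableOp (isPresentation_scalars b).indexing (isPresentation_scalars b).indexing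
      (isPresentation_scalars b).indexing fun x y => x * y :=
  IsPresentation.computableOp _ _ _
    (FormalSum.primrec_bind₂ (primrec_structureConst b))
    (FormalSum.eval_bind₂ _ _ _ (smulBilin K K) _ (eval_structureConst b))

theorem admissible_indexings (b : Module.Basis (Fin d) ℚ K) :
    Admissible (isPresentation_scalars b).indexing (isPresentation_cellState (n := n) b).indexing
      (isPresentation_fock (n := n) b).indexing where
  add_K := computableOp_add _
  mul_K := computableOp_mul b
  add_S := computableOp_add _
  smul_S := computableOp_smul b (fun a => (Pi.single a 1 : CellState K n)) _
  add_H := computableOp_add _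
  smul_H := computableOp_smul b (fun l => (Finsupp.single (config l) 1 : Fock K n)) _
  tensor_H := computableOp_tensor b

end

end QuantumGandy

namespace QuantumGandy

section

variable {K : IntermediateField ℚ ℂ} {n : ℕ} [NeZero n]

/-! ### The hermitian form -/

theorem fockInner_add_left (ψ ψ' φ : Fock K n) :
    fockInner (ψ + ψ') φ = fockInner ψ φ + fockInner ψ' φ :=
  Finsupp.sum_add_index' (by simp) (by simp [add_mul])

theorem fockInner_add_right (ψ φ φ' : Fock K n) :
    fockInner ψ (φ + φ') = fockInner ψ φ + fockInner ψ φ' := by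
  simp [fockInner, mul_add, Finsupp.sum_add]

theorem fockInner_sub_right (ψ φ φ' : Fock K n) :
    fockInner ψ (φ - φ') = fockInner ψ φ - fockInner ψ φ' := by
  simp [fockInner, mul_sub, Finsupp.sum_sub]

@[simp]
theorem fockInner_zero_left (φ : Fock K n) : fockInner 0 φ = 0 :=
  Finsupp.sum_zero_index

@[simp]
theorem fockInner_zero_right (φ : Fock K n) : fockInner φ 0 = 0 := by
  simp [fockInner]

theorem fockInner_single_left (c : Config n) (a : K) (φ : Fock K n) :
    fockInner (Finsupp.single c a) φ = star (a : ℂ) * φ c :=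
  Finsupp.sum_single_index (by simp)

theorem star_fockInner (ψ φ : Fock K n) : star (fockInner ψ φ) = fockInner φ ψ := by
  induction ψ using Finsupp.induction_linear with
  | zero => simp
  | add ψ ψ' h h' => rw [fockInner_add_left, fockInner_add_right, star_add, h, h']
  | single c a =>
    induction φ using Finsupp.induction_linear with
    | zero => simp
    | add ψ ψ' h h' => rw [fockInner_add_left, fockInner_add_right, star_add, h, h']
    | single e b =>
      rw [fockInner_single_left, fockInner_single_left]
      by_cases h : c = e
      · subst h
        simp [mul_comm]
      · simp [Finsupp.single_eq_of_ne h, Finsupp.single_eq_of_ne (Ne.symm h)]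

/-- Only the real part is assumed to vanish because polarization over `K`, which may not contain
`i`, controls only real parts. -/
theorem eq_zero_of_re_fockInner_self {ψ : Fock K n} (h : (fockInner ψ ψ).re = 0) : ψ = 0 := by
  have h1 : (fockInner ψ ψ).re = ∑ c ∈ ψ.support, Complex.normSq (ψ c : ℂ) := by
    rw [fockInner, Finsupp.sum, Complex.re_sum]
    refine Finset.sum_congr rfl fun c _ => ?_
    rw [Complex.star_def, ← Complex.normSq_eq_conj_mul_self, Complex.ofReal_re]
  rw [h1, Finset.sum_eq_zero_iff_of_nonneg fun c _ => Complex.normSq_nonneg _] at h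
  refine Finsupp.ext fun c => ?_
  by_contra hc
  exact hc (by simpa using h c (Finsupp.mem_support_iff.mpr hc))

theorem fockInner_eq_finsum (ψ φ : Fock K n) :
    fockInner ψ φ = ∑ᶠ c, star (ψ c : ℂ) * (φ c : ℂ) := by
  rw [fockInner, Finsupp.sum, finsum_eq_sum_of_support_subset]
  intro c hc
  simp only [Function.mem_support, Finset.mem_coe, Finsupp.mem_support_iff] at hc ⊢
  rintro h
  simp [h] at hc

/-! ### Operators that act on one cell -/

/-- The signed permutation of the states of the cell `C` that sends `e_x` to `ε x e_{σ x}`. -/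
noncomputable def cellOp (C : Cell) (σ : Fin n → Fin n) (ε : Fin n → K) :
    Module.End K (Fock K n) :=
  Finsupp.linearCombination K fun c => Finsupp.single (c.update C (σ (c C))) (ε (c C))

/-- The conditions under which `cellOp C σ ε` is a self-adjoint involution. -/
structure IsReflection (σ : Fin n → Fin n) (ε : Fin n → K) : Prop where
  involutive : Function.Involutive σ
  sign_comp : ∀ x, ε (σ x) = ε x
  sign : ∀ x, ε x = 1 ∨ ε x = -1

/-- The operator that resets the cell `C` to the state `e_x`. -/
noncomputable def setOp (C : Cell) (x : Fin n) : Module.End K (Fock K n) :=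
  Finsupp.lmapDomain K K fun c => c.update C x

theorem cellOp_single (C : Cell) (σ : Fin n → Fin n) (ε : Fin n → K) (c : Config n) (a : K) :
    cellOp C σ ε (Finsupp.single c a) = Finsupp.single (c.update C (σ (c C))) (a * ε (c C)) := by
  simp [cellOp]

theorem setOp_single (C : Cell) (x : Fin n) (c : Config n) (a : K) :
    (setOp C x : Module.End K (Fock K n)) (Finsupp.single c a) =
      Finsupp.single (c.update C x) a := by
  simp [setOp, Finsupp.mapDomain_single]

theorem involutive_update {α : Type*} {σ : Fin n → Fin n} (h : Function.Involutive σ) (C : α) :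
    Function.Involutive fun c : α →₀ Fin n => c.update C (σ (c C)) := by
  classical
  intro c
  refine Finsupp.ext fun D => ?_
  by_cases hD : D = C
  · subst hD
    simp [h (c D)]
  · simp [Function.update_of_ne hD]

section

variable {σ : Fin n → Fin n} {ε : Fin n → K} (h : IsReflection σ ε)

include h

theorem cellOp_apply (C : Cell) (ψ : Fock K n) (c : Config n) :
    cellOp C σ ε ψ c = ε (c C) * ψ (c.update C (σ (c C))) := by
  induction ψ using Finsupp.induction_linear with
  | zero => simp
  | add ψ ψ' h h' => simp [h, h', mul_add]
  | single e a =>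
    rw [cellOp_single]
    have hi := involutive_update h.involutive C
    by_cases he : e.update C (σ (e C)) = c
    · subst he
      have := hi e
      simp only at this
      rw [this, Finsupp.single_eq_same, Finsupp.single_eq_same]
      simp [h.sign_comp, mul_comm]
    · have he' : e ≠ c.update C (σ (c C)) := by
        rintro rfl
        exact he (hi c)
      rw [Finsupp.single_eq_of_ne (Ne.symm he), Finsupp.single_eq_of_ne he'.symm, mul_zero]

omit [NeZero n] in
theorem star_sign (x : Fin n) : star (ε x : ℂ) = ε x := by
  rcases h.sign x with h | h <;> simp [h]

omit [NeZero n] in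
theorem sign_mul_sign (x : Fin n) : ε x * ε x = 1 := by
  rcases h.sign x with h | h <;> simp [h]

theorem cellOp_mul_self (C : Cell) : cellOp C σ ε * cellOp C σ ε = 1 := by
  refine LinearMap.ext fun ψ => Finsupp.ext fun c => ?_
  have hi := involutive_update h.involutive C c
  simp only at hi
  rw [Module.End.mul_apply, cellOp_apply h, cellOp_apply h, hi, ← mul_assoc]
  simp [h.sign_comp, sign_mul_sign h]

theorem fockInner_cellOp (C : Cell) (ψ φ : Fock K n) :
    fockInner (cellOp C σ ε ψ) φ = fockInner ψ (cellOp C σ ε φ) := by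
  induction ψ using Finsupp.induction_linear with
  | zero => simp
  | add ψ ψ' h h' => rw [map_add, fockInner_add_left, fockInner_add_left, h, h']
  | single c a =>
    rw [cellOp_single, fockInner_single_left, fockInner_single_left, cellOp_apply h]
    have := star_sign h (c C)
    simp only [MulMemClass.coe_mul, star_mul', this]
    ring

/-- The operator permutes the configurations of the complement, which reindexes the partial trace,
and its signs occur squared. -/
theorem regionDensity_cellOp {A : Set Cell} {C : Cell} (hC : C ∉ A) (ψ : Fock K n) :
    regionDensity A (cellOp C σ ε ψ) = regionDensity A ψ := by
  classical
  funext a a'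
  have hj : ∀ (a : ConfigOn n A) (d : {C // ¬ C ∈ A} →₀ Fin n) (x : Fin n),
      (join A a d).update C x = join A a (d.update ⟨C, hC⟩ x) := by
    intro a d x
    refine Finsupp.ext fun D => ?_
    by_cases hD : D = C
    · subst hD
      simp [join, hC]
    · rw [Finsupp.coe_update, Function.update_of_ne hD]
      by_cases hDA : D ∈ A
      · simp [join, hDA]
      · simp [join, hDA, Function.update_of_ne, hD]
  have hv : ∀ (a : ConfigOn n A) (d : {C // ¬ C ∈ A} →₀ Fin n),
      join A a d C = d ⟨C, hC⟩ := by
    intro a d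
    simp [join, hC]
  rw [regionDensity, regionDensity, partialTrace, partialTrace]
  refine Eq.trans (finsum_congr fun d => ?_)
    (finsum_comp_equiv (involutive_update h.involutive
      (⟨C, hC⟩ : {C // ¬ C ∈ A})).toPerm)
  simp only [pureDensity, cellOp_apply h, hj, hv, Function.Involutive.coe_toPerm,
    MulMemClass.coe_mul, star_mul', star_sign h]
  have := congrArg (fun x : K => (x : ℂ)) (sign_mul_sign h (d ⟨C, hC⟩))
  simp only [MulMemClass.coe_mul, OneMemClass.coe_one] at this
  linear_combination ((ψ (join A a (d.update ⟨C, hC⟩ (σ (d ⟨C, hC⟩)))) : ℂ) *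
    star (ψ (join A a' (d.update ⟨C, hC⟩ (σ (d ⟨C, hC⟩)))) : ℂ)) * this

end

/-- A configuration of the whole space is a pair of configurations of a region and of its
complement. -/
noncomputable def joinEquiv (A : Set Cell) :
    ConfigOn n A × ({C // ¬ C ∈ A} →₀ Fin n) ≃ Config n where
  toFun p := join A p.1 p.2
  invFun c := (c.subtypeDomain (· ∈ A), c.subtypeDomain (¬ · ∈ A))
  left_inv p := by
    classical
    exact Prod.ext (Finsupp.subtypeDomain_piecewise _ _)
      (Finsupp.subtypeDomain_not_piecewise _ _)
  right_inv c := by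
    refine Finsupp.ext fun C => ?_
    by_cases hC : C ∈ A <;> simp [join, hC]

/-- The expectation of an operator on a cell of `A` is the trace of its product with the density
matrix of `A`. This is how bounded velocity enters. -/
theorem fockInner_cellOp_eq_finsum {σ : Fin n → Fin n} {ε : Fin n → K} (h : IsReflection σ ε)
    {A : Set Cell} {D : Cell} (hD : D ∈ A) (ψ : Fock K n) :
    fockInner ψ (cellOp D σ ε ψ) =
      ∑ᶠ a : ConfigOn n A, (ε (a ⟨D, hD⟩) : ℂ) *
        regionDensity A ψ (a.update ⟨D, hD⟩ (σ (a ⟨D, hD⟩))) a := by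
  classical
  have hj : ∀ (a : ConfigOn n A) (d : {C // ¬ C ∈ A} →₀ Fin n) (x : Fin n),
      (join A a d).update D x = join A (a.update ⟨D, hD⟩ x) d := by
    intro a d x
    refine Finsupp.ext fun C => ?_
    by_cases hC : C = D
    · subst hC
      simp [join, hD]
    · rw [Finsupp.coe_update, Function.update_of_ne hC]
      by_cases hCA : C ∈ A
      · simp [join, hCA, Function.update_of_ne, hC]
      · simp [join, hCA]
  have hv : ∀ (a : ConfigOn n A) (d : {C // ¬ C ∈ A} →₀ Fin n),
      join A a d D = a ⟨D, hD⟩ := by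
    intro a d
    simp [join, hD]
  -- The sum over configurations splits into one over `A` and one over its complement; the latter is
  -- the partial trace.
  rw [fockInner_eq_finsum, ← finsum_comp_equiv (joinEquiv A), finsum_curry]
  · refine finsum_congr fun a => ?_
    rw [regionDensity, partialTrace, mul_finsum]
    refine finsum_congr fun d => ?_
    simp only [joinEquiv, Equiv.coe_fn_mk, cellOp_apply h, hj, hv, pureDensity,
      MulMemClass.coe_mul]
    ring
  · refine (ψ.support.finite_toSet.preimage (joinEquiv A).injective.injOn).subset ?_
    intro p hp
    simp only [Function.mem_support] at hp
    simp only [Set.mem_preimage, Finset.mem_coe, Finsupp.mem_support_iff]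
    intro h0
    simp [h0] at hp

/-- Resets lie in the algebra generated by reflections. Flipping the sign of `e_y` gives an operator
`S` such that `(1 - S) / 2` projects onto the configurations with `y` in `C`; the transposition of
`x` and `y` then writes `x`. -/
theorem commute_setOp {C : Cell} {Q : Module.End K (Fock K n)}
    (hQ : ∀ (σ : Fin n → Fin n) (ε : Fin n → K), IsReflection σ ε → Commute Q (cellOp C σ ε))
    (x : Fin n) : Commute Q (setOp C x) := by
  have h1 : (setOp C x : Module.End K (Fock K n)) = (2 : K)⁻¹ • ∑ y : Fin n,
      cellOp C (Equiv.swap x y) (fun _ => 1) *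
        (1 - cellOp C id fun z => if z = y then -1 else 1) := by
    refine Finsupp.lhom_ext fun c a => ?_
    have h2 : ∀ y : Fin n, (cellOp C (Equiv.swap x y) (fun _ => 1) *
        (1 - cellOp C id fun z => if z = y then -1 else 1) : Module.End K (Fock K n))
          (Finsupp.single c a) = if c C = y then (2 : K) • Finsupp.single (c.update C x) a
            else 0 := by
      intro y
      rw [Module.End.mul_apply, LinearMap.sub_apply, Module.End.one_apply, cellOp_single,
        id, Finsupp.update_self]
      split_ifs with hy
      · rw [mul_neg, mul_one, Finsupp.single_neg, sub_neg_eq_add, ← two_smul K, map_smul,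
          cellOp_single, mul_one, hy, Equiv.swap_apply_right]
      · simp
    rw [LinearMap.smul_apply, LinearMap.sum_apply, Finset.sum_congr rfl fun y _ => h2 y,
      Finset.sum_ite_eq, if_pos (Finset.mem_univ _), smul_smul, inv_mul_cancel₀ two_ne_zero,
      one_smul, setOp_single]
  rw [h1]
  have h2 : ∀ y, Commute Q (cellOp C (Equiv.swap x y) fun _ => 1) := fun y =>
    hQ _ _ ⟨fun z => DFunLike.congr_fun (Equiv.swap_swap x y) z, fun _ => rfl, fun _ => Or.inl rfl⟩
  have h3 : ∀ y, Commute Q (cellOp C id fun z => if z = y then -1 else 1) := fun y => by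
    refine hQ _ _ ⟨fun _ => rfl, fun _ => rfl, fun z => ?_⟩
    by_cases hz : z = y <;> simp [hz]
  have h4 : ∀ y, Commute Q (1 - cellOp C id fun z => if z = y then -1 else 1) := fun y =>
    Commute.sub_right (R := Module.End K (Fock K n)) (Commute.one_right Q) (h3 y)
  have h5 := Commute.sum_right Finset.univ _ Q fun y _ => (h2 y).mul_right (h4 y)
  exact h5.smul_right _

end

end QuantumGandy

namespace QuantumGandy

/-! ### Neighbourhoods -/

/-- The translations by vectors with coordinates of absolute value at most two. -/
noncomputable def nearOffsets : Finset Cell := Finset.Icc (-2, -2, -2) (2, 2, 2)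

/-- Each coordinate of a point exceeds that of the corner of its cell by less than `1`, and the two
points differ by at most `1`. The bound `2` is not sharp; any finite set of offsets would serve. -/
theorem sub_mem_nearOffsets {C D : Cell} (h : C ∈ around {D}) : D - C ∈ nearOffsets := by
  obtain ⟨p, hp, hp'⟩ := h
  simp only [area, regionSpace, Set.mem_singleton_iff, Set.iUnion_iUnion_eq_left,
    Set.mem_iUnion, exists_prop] at hp'
  obtain ⟨r, hr, hpr⟩ := hp'
  rw [Metric.mem_closedBall, dist_eq_norm] at hpr
  have hd : ∀ i, |p i - r i| ≤ 1 := fun i => by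
    simpa using (PiLp.norm_apply_le (p - r) i).trans hpr
  have key : ∀ {a b : ℤ} {s t : ℝ}, s ∈ Set.Ico (a : ℝ) (a + 1) → t ∈ Set.Ico (b : ℝ) (b + 1) →
      |s - t| ≤ 1 → -2 ≤ b - a ∧ b - a ≤ 2 := by
    intro a b s t hs ht hst
    rw [abs_le] at hst
    constructor
    · have : ((-2 : ℤ) : ℝ) ≤ ((b - a : ℤ) : ℝ) := by
        push_cast
        linarith [hs.1, ht.2]
      exact_mod_cast this
    · have : ((b - a : ℤ) : ℝ) ≤ ((2 : ℤ) : ℝ) := by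
        push_cast
        linarith [hs.2, ht.1]
      exact_mod_cast this
  have h0 := key hp.1 hr.1 (hd 0)
  have h1 := key hp.2.1 hr.2.1 (hd 1)
  have h2 := key hp.2.2 hr.2.2 (hd 2)
  rw [nearOffsets, Finset.mem_Icc]
  exact ⟨⟨h0.1, h1.1, h2.1⟩, ⟨h0.2, h1.2, h2.2⟩⟩

section

variable {K : IntermediateField ℚ ℂ} {n : ℕ} [NeZero n]

/-! ### Translations -/

theorem shift_single (v : Cell) (c : Config n) (a : K) :
    shift (K := K) (n := n) v (Finsupp.single c a) = Finsupp.single (shiftConfig v c) a := by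
  simp [shift, Finsupp.mapDomain_single]

theorem shiftConfig_apply (v : Cell) (c : Config n) (C : Cell) :
    shiftConfig v c C = c (C - v) := by
  simp [shiftConfig, Finsupp.equivMapDomain_apply, sub_eq_add_neg]

theorem shiftConfig_update (v : Cell) (c : Config n) (C : Cell) (x : Fin n) :
    shiftConfig v (c.update C x) = (shiftConfig v c).update (C + v) x := by
  refine Finsupp.ext fun D => ?_
  rw [shiftConfig_apply, Finsupp.coe_update, Finsupp.coe_update]
  by_cases hD : D = C + v
  · subst hD
    simp
  · rw [Function.update_of_ne hD, Function.update_of_ne, shiftConfig_apply]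
    rintro rfl
    exact hD (by simp)

theorem shiftConfig_config (v : Cell) (l : CellList n) :
    shiftConfig v (config l) = config (l.map fun t => (t.1 + v, t.2)) := by
  induction l with
  | nil =>
    refine Finsupp.ext fun D => ?_
    rw [shiftConfig_apply]
    rfl
  | cons t l ih => rw [config_cons, shiftConfig_update, ih, List.map_cons, config_cons]

theorem shift_setOp (v C : Cell) (x : Fin n) (ψ : Fock K n) :
    shift (K := K) (n := n) v ((setOp C x : Module.End K (Fock K n)) ψ) =
      (setOp (C + v) x : Module.End K (Fock K n)) (shift (K := K) (n := n) v ψ) := by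
  induction ψ using Finsupp.induction_linear with
  | zero => simp
  | add ψ φ h h' => rw [map_add, map_add, map_add, map_add, h, h']
  | single c a => rw [setOp_single, shift_single, shift_single, setOp_single, shiftConfig_update]

/-! ### Conjugation of local operators by the evolution -/

/-- A unitary evolution operator that commutes with translations and propagates information with
bounded velocity, together with its inverse. -/
structure LocalUnitary (K : IntermediateField ℚ ℂ) (n : ℕ) [NeZero n] where
  /-- The evolution operator. -/
  op : Module.End K (Fock K n)
  /-- The inverse of the evolution operator. -/
  inv : Module.End K (Fock K n)
  op_mul_inv : op * inv = 1
  inv_mul_op : inv * op = 1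
  isometry : ∀ ψ φ, fockInner (op ψ) (op φ) = fockInner ψ φ
  op_shift : ∀ v ψ, op (shift (K := K) (n := n) v ψ) = shift (K := K) (n := n) v (op ψ)
  bounded : ∀ A ψ φ, regionDensity (around A) ψ = regionDensity (around A) φ →
    regionDensity A (op ψ) = regionDensity A (op φ)

namespace LocalUnitary

variable (U : LocalUnitary K n)

theorem op_inv (ψ : Fock K n) : U.op (U.inv ψ) = ψ :=
  LinearMap.congr_fun U.op_mul_inv ψ

theorem inv_op (ψ : Fock K n) : U.inv (U.op ψ) = ψ :=
  LinearMap.congr_fun U.inv_mul_op ψ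

theorem fockInner_inv (ψ φ : Fock K n) : fockInner ψ (U.inv φ) = fockInner (U.op ψ) φ := by
  rw [← U.isometry, U.op_inv]

theorem inv_shift (v : Cell) (ψ : Fock K n) : U.inv (shift (K := K) (n := n) v ψ) = shift (K := K) (n := n) v (U.inv ψ) := by
  rw [← U.inv_op (shift (K := K) (n := n) v (U.inv ψ)), U.op_shift, U.op_inv]

/-- A self-adjoint operator commutes with a self-adjoint involution that preserves its
expectations. -/
theorem commute_of_fockInner_eq {Z R : Module.End K (Fock K n)}
    (hZ : ∀ ψ φ, fockInner (Z ψ) φ = fockInner ψ (Z φ))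
    (hR : ∀ ψ φ, fockInner (R ψ) φ = fockInner ψ (R φ)) (hRR : R * R = 1)
    (h : ∀ ψ, fockInner (R ψ) (Z (R ψ)) = fockInner ψ (Z ψ)) : Commute Z R := by
  have hRR' : ∀ ψ, R (R ψ) = ψ := LinearMap.congr_fun hRR
  -- Expanding the expectation at `ψ + φ` gives two cross terms, conjugate by self-adjointness;
  -- hence equality of real parts only.
  have hB : ∀ ψ φ, (fockInner (R ψ) (Z (R φ) - R (Z φ))).re = 0 := by
    intro ψ φ
    have h1 : fockInner (R ψ) (Z (R φ)) + fockInner (R φ) (Z (R ψ)) =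
        fockInner ψ (Z φ) + fockInner φ (Z ψ) := by
      have := h (ψ + φ)
      simp only [map_add, fockInner_add_left, fockInner_add_right, h ψ, h φ] at this
      linear_combination this
    rw [← star_fockInner (Z (R ψ)) (R φ), hZ, ← star_fockInner (Z ψ) φ, hZ] at h1
    have h2 := congrArg Complex.re h1
    simp only [Complex.add_re, Complex.star_def, Complex.conj_re] at h2
    rw [fockInner_sub_right, hR ψ (R (Z φ)), hRR', Complex.sub_re]
    linarith
  refine LinearMap.ext fun φ => sub_eq_zero.mp ?_
  refine eq_zero_of_re_fockInner_self ?_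
  -- This choice makes the left argument equal to the right one, since `R` is an involution: the
  -- squared norm vanishes.
  have := hB (R (Z (R φ) - R (Z φ))) φ
  rwa [hRR'] at this

/-- A reflection of `C` leaves the density matrix of `around {D}` unchanged, hence also that of
`{D}` after the evolution, and with it the expectation of the observable on `D`. -/
theorem commute_conj_cellOp {C D : Cell} (hCD : C ∉ around {D}) {σ τ : Fin n → Fin n}
    {ε δ : Fin n → K} (hσ : IsReflection σ ε) (hτ : IsReflection τ δ) :
    Commute (U.inv * cellOp D τ δ * U.op) (cellOp C σ ε) := by
  refine commute_of_fockInner_eq (fun ψ φ => ?_) (fockInner_cellOp hσ C) (cellOp_mul_self hσ C)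
    fun ψ => ?_
  · simp only [Module.End.mul_apply]
    rw [U.fockInner_inv, ← fockInner_cellOp hτ, ← star_fockInner φ, U.fockInner_inv,
      star_fockInner]
  · simp only [Module.End.mul_apply]
    rw [U.fockInner_inv, U.fockInner_inv,
      fockInner_cellOp_eq_finsum hτ (Set.mem_singleton D),
      fockInner_cellOp_eq_finsum hτ (Set.mem_singleton D),
      U.bounded {D} _ _ (regionDensity_cellOp hσ hCD ψ)]

/-- The conjugate by the evolution of the operator that resets a cell. -/
noncomputable def conjSetOp (C : Cell) (x : Fin n) : Module.End K (Fock K n) :=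
  U.op * setOp C x * U.inv

/-- Reflections are replaced by resets first at `C`, then at `D`. Conjugating by `U.op` in between
moves the evolution from the operator on `D` to the one on `C`, so no velocity bound on the inverse
is needed. -/
theorem conjSetOp_setOp {C D : Cell} (hCD : C ∉ around {D}) (x y : Fin n) (ψ : Fock K n) :
    U.conjSetOp C x ((setOp D y : Module.End K (Fock K n)) ψ) =
      (setOp D y : Module.End K (Fock K n)) (U.conjSetOp C x ψ) := by
  have h1 : Commute (U.conjSetOp C x) (setOp D y) := by
    refine commute_setOp (fun τ δ hτ => ?_) y
    have h2 : Commute (U.inv * cellOp D τ δ * U.op) (setOp C x) :=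
      commute_setOp (fun σ ε hσ => U.commute_conj_cellOp hCD hσ hτ) x
    have h3 := congrArg (fun X => U.op * X * U.inv) h2.eq
    refine Commute.symm ?_
    calc cellOp D τ δ * U.conjSetOp C x
        = (U.op * U.inv) * cellOp D τ δ * U.op * setOp C x * U.inv := by
          rw [U.op_mul_inv, one_mul, conjSetOp]; simp only [mul_assoc]
      _ = U.op * (U.inv * cellOp D τ δ * U.op * setOp C x) * U.inv := by simp only [mul_assoc]
      _ = U.op * (setOp C x * (U.inv * cellOp D τ δ * U.op)) * U.inv := h3
      _ = U.conjSetOp C x * cellOp D τ δ * (U.op * U.inv) := by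
          rw [conjSetOp]; simp only [mul_assoc]
      _ = _ := by rw [U.op_mul_inv, mul_one]
  exact LinearMap.congr_fun h1.eq ψ

theorem conjSetOp_shift (C v : Cell) (x : Fin n) (ψ : Fock K n) :
    U.conjSetOp (C + v) x (shift (K := K) (n := n) v ψ) = shift (K := K) (n := n) v (U.conjSetOp C x ψ) := by
  simp only [conjSetOp, Module.End.mul_apply]
  rw [U.inv_shift, ← shift_setOp, U.op_shift]

/-- The recursion that computes the evolution: prepending an entry is a reset, which becomes its
conjugate after `U.op`. -/
theorem op_single_config_cons (t : Cell × Fin n) (l : CellList n) :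
    U.op (Finsupp.single (config (t :: l)) 1) =
      U.conjSetOp t.1 t.2 (U.op (Finsupp.single (config l) 1)) := by
  simp only [conjSetOp, Module.End.mul_apply]
  rw [U.inv_op, setOp_single, config_cons]

end LocalUnitary

end


/-! ### Finite tables -/

open Primrec

theorem exists_primrec_eqOn {α β : Type} [Primcodable α] [Primcodable β] [Inhabited β]
    (f : α → β) {S : Set α} (hS : S.Finite) : ∃ g : α → β, Primrec g ∧ ∀ a ∈ S, g a = f a := by
  classical
  induction S, hS using Set.Finite.induction_on with
  | empty => exact ⟨fun _ => default, Primrec.const _, by simp⟩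
  | @insert a S _ _ ih =>
    obtain ⟨g, hg, hgf⟩ := ih
    refine ⟨fun x => if x = a then f a else g x,
      Primrec.ite (Primrec.eq.comp Primrec.id (Primrec.const a)) (Primrec.const _) hg, ?_⟩
    intro x hx
    by_cases h : x = a
    · simp [h]
    · simp [h, hgf x (by simpa [h] using hx)]

section

variable {K : IntermediateField ℚ ℂ} {n : ℕ} [NeZero n]

/-! ### The neighbourhood of a cell in a configuration -/

/-- The content of the neighbourhood of `C`, translated to the origin. -/
noncomputable def innerPart (l : CellList n) (C : Cell) : CellList n :=
  nearOffsets.toList.map fun v => (v, config l (v + C))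

/-- The content of the cells outside the neighbourhood of `C`. -/
noncomputable def outerPart (l : CellList n) (C : Cell) : CellList n :=
  l.filter fun t => ¬ t.1 + -C ∈ nearOffsets.toList

theorem primrec_innerPart : Primrec₂ (innerPart (n := n)) :=
  list_map (Primrec.const _) (snd.pair (primrec_config_apply.comp (fst.comp fst)
    (primrec_cell_add.comp snd (snd.comp fst))))

theorem primrec_cell_neg : Primrec fun C : Cell => -C := by
  have h : Primrec fun a : ℤ => -a := by
    refine (primrec_int_subNat.comp primrec_int_toNat_neg primrec_int_toNat).of_eq fun a => ?_
    have := Int.toNat_sub_toNat_neg a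
    omega
  exact (h.comp fst).pair ((h.comp (fst.comp snd)).pair (h.comp (snd.comp snd)))

omit [NeZero n] in
theorem primrec_outerPart : Primrec₂ (outerPart (n := n)) := by
  classical
  have h1 : PrimrecRel fun (v w : Cell) => v = w := Primrec.eq
  have h2 : PrimrecRel fun (t : Cell × Fin n) (C : Cell) => ¬ t.1 + -C ∈ nearOffsets.toList := by
    refine PrimrecPred.of_eq (p := fun p : (Cell × Fin n) × Cell =>
      ¬ ∃ v ∈ nearOffsets.toList, v = p.1.1 + -p.2) (PrimrecPred.not
        (h1.exists_mem_list.comp (Primrec.const _) (primrec_cell_add.comp (fst.comp fst)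
          (primrec_cell_neg.comp snd)))) fun p => by simp
  exact h2.listFilter.of_eq fun l C => by simp [outerPart]

/-- The two parts concern disjoint sets of cells, so their order does not matter; within the outer
part the order of entries, hence precedence, is kept. -/
theorem config_outerPart_append (l : CellList n) (C : Cell) :
    config (outerPart l C ++ (innerPart l C).map fun t => (t.1 + C, t.2)) = config l := by
  have hm : ((innerPart l C).map fun t => (t.1 + C, t.2)) =
      (nearOffsets.toList.map (· + C)).map fun D => (D, config l D) := by
    simp [innerPart, Function.comp_def]
  rw [hm]
  refine Finsupp.ext fun D => ?_
  by_cases hD : D + -C ∈ nearOffsets.toList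
  · have h1 : ∀ (m k : CellList n), config (outerPart m C ++ k) D = config k D := by
      intro m k
      induction m with
      | nil => rfl
      | cons t m ih =>
        by_cases ht : t.1 + -C ∈ nearOffsets.toList
        · have : outerPart (t :: m) C = outerPart m C := by
            simp only [outerPart, List.filter_cons, ht]; simp
          rw [this, ih]
        · have : outerPart (t :: m) C = t :: outerPart m C := by
            simp only [outerPart, List.filter_cons, ht]; simp
          rw [this, List.cons_append, config_cons, Finsupp.coe_update, Function.update_of_ne, ih]
          rintro rfl
          exact ht hD
    rw [h1]
    exact config_map_graph _ _ (List.mem_map.mpr ⟨_, hD, by simp⟩)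
  · have h1 : ∀ (m k : CellList n), config k D = 0 →
        config (outerPart m C ++ k) D = config m D := by
      intro m k hk
      induction m with
      | nil => exact hk
      | cons t m ih =>
        by_cases ht : t.1 + -C ∈ nearOffsets.toList
        · have : outerPart (t :: m) C = outerPart m C := by
            simp only [outerPart, List.filter_cons, ht]; simp
          rw [this, ih, config_cons, Finsupp.coe_update, Function.update_of_ne]
          rintro rfl
          exact hD ht
        · have : outerPart (t :: m) C = t :: outerPart m C := by
            simp only [outerPart, List.filter_cons, ht]; simp
          rw [this, List.cons_append, config_cons, config_cons, Finsupp.coe_update,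
            Finsupp.coe_update, Function.update_apply, Function.update_apply, ih]
    refine h1 _ _ (config_apply_of_notMem _ _ fun t ht => ?_)
    simp only [List.mem_map] at ht
    obtain ⟨_, ⟨v, hv, rfl⟩, rfl⟩ := ht
    rintro rfl
    exact hD (by simpa using hv)

/-- The lists themselves, not just their configurations, are finitely many: every offset is listed,
in a fixed order, quiescent or not. -/
theorem finite_range_innerPart : (Set.range fun p : Fin n × CellList n × Cell =>
    (p.1, innerPart p.2.1 p.2.2)).Finite := by
  have h : ∀ L : List Cell,
      (Set.range fun c : Cell → Fin n => L.map fun v => (v, c v)).Finite := by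
    intro L
    induction L with
    | nil => exact (Set.finite_singleton []).subset (by rintro _ ⟨c, rfl⟩; simp)
    | cons v L ih =>
      refine ((Set.finite_univ (α := Fin n)).image2 (fun x m => (v, x) :: m) ih).subset ?_
      rintro _ ⟨c, rfl⟩
      exact ⟨c v, trivial, _, ⟨c, rfl⟩, rfl⟩
  refine ((Set.finite_univ (α := Fin n)).prod (h nearOffsets.toList)).subset ?_
  rintro _ ⟨p, rfl⟩
  exact ⟨trivial, fun v => config p.2.1 (v + p.2.2), rfl⟩

/-! ### Computation of the evolution -/

namespace LocalUnitary

variable (U : LocalUnitary K n) {d : ℕ} (b : Module.Basis (Fin d) ℚ K)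

theorem exists_localTable : ∃ f : Fin n × CellList n → FormalSum (Fin d × CellList n),
    Primrec f ∧ ∀ x l C, FormalSum.eval (fockVector b) (f (x, innerPart l C)) =
      U.conjSetOp 0 x (Finsupp.single (config (innerPart l C)) 1) := by
  choose f hf using fun p : Fin n × CellList n => (isPresentation_fock (n := n) b).surjective
    (U.conjSetOp 0 p.1 (Finsupp.single (config p.2) 1))
  obtain ⟨g, hg, hgf⟩ := exists_primrec_eqOn f (finite_range_innerPart (n := n))
  exact ⟨g, hg, fun x l C => by rw [hgf _ ⟨(x, l, C), rfl⟩, hf]⟩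

/-- The entries of `m` are resets that commute with the conjugated reset, so they can be prepended
to each term of the result. -/
theorem conjSetOp_append (C : Cell) (x : Fin n) (m k : CellList n)
    (hm : ∀ t ∈ m, C ∉ around {t.1}) (f : FormalSum (Fin d × CellList n))
    (hf : FormalSum.eval (fockVector b) f = U.conjSetOp C x (Finsupp.single (config k) 1)) :
    FormalSum.eval (fockVector b) (f.map fun u => ((u.1.1, m ++ u.1.2), u.2)) =
      U.conjSetOp C x (Finsupp.single (config (m ++ k)) 1) := by
  induction m with
  | nil => simpa using hf
  | cons t m ih =>
    have ih := ih fun t ht => hm t (by simp [ht])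
    rw [List.cons_append, config_cons, ← setOp_single,
      U.conjSetOp_setOp (hm t (by simp)), ← ih]
    have h := FormalSum.map_eval (fockVector b)
      ((setOp t.1 t.2 : Module.End K (Fock K n)).restrictScalars ℚ)
      (f.map fun u => ((u.1.1, m ++ u.1.2), u.2))
    have h' := FormalSum.eval_map
      (fun p => (setOp t.1 t.2 : Module.End K (Fock K n)) (fockVector b p)) (fockVector b)
      (fun p : Fin d × CellList n => (p.1, t :: p.2)) (fun p => by
        rw [fockVector, fockVector, map_smul, setOp_single, config_cons])
      (f.map fun u => ((u.1.1, m ++ u.1.2), u.2))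
    rw [List.map_map] at h'
    exact h'.trans h.symm

/-- The action of `conjSetOp C x` on the configuration represented by `l`, in terms of the
table `f` of its action near the origin. -/
noncomputable def localStep (f : Fin n × CellList n → FormalSum (Fin d × CellList n))
    (t : Cell × Fin n) (l : CellList n) : FormalSum (Fin d × CellList n) :=
  (f (t.2, innerPart l t.1)).map fun u =>
    ((u.1.1, outerPart l t.1 ++ u.1.2.map fun s => (s.1 + t.1, s.2)), u.2)

theorem eval_localStep {f : Fin n × CellList n → FormalSum (Fin d × CellList n)}
    (hf : ∀ x l C, FormalSum.eval (fockVector b) (f (x, innerPart l C)) =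
      U.conjSetOp 0 x (Finsupp.single (config (innerPart l C)) 1))
    (t : Cell × Fin n) (l : CellList n) :
    FormalSum.eval (fockVector b) (localStep f t l) =
      U.conjSetOp t.1 t.2 (Finsupp.single (config l) 1) := by
  obtain ⟨C, x⟩ := t
  have h1 := U.conjSetOp_append b C x (outerPart l C)
    ((innerPart l C).map fun s => (s.1 + C, s.2)) ?_
    ((f (x, innerPart l C)).map fun u => ((u.1.1, u.1.2.map fun s => (s.1 + C, s.2)), u.2)) ?_
  · rw [config_outerPart_append] at h1
    rw [← h1, List.map_map]
    rfl
  -- A cell whose offset from `C` is not near has a neighbourhood that misses `C`, as locality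
  -- requires.
  · intro t ht h
    have := sub_mem_nearOffsets h
    simp only [outerPart, List.mem_filter, Finset.mem_toList, decide_eq_true_eq] at ht
    exact ht.2 (by rwa [← sub_eq_add_neg])
  -- The action at `C` is the translate by `C` of the tabulated action at the origin.
  · have h2 := U.conjSetOp_shift 0 C x (Finsupp.single (config (innerPart l C)) 1)
    rw [shift_single, shiftConfig_config, zero_add, ← hf] at h2
    rw [h2]
    have h := FormalSum.map_eval (fockVector b)
      ((shift (K := K) (n := n) C).restrictScalars ℚ) (f (x, innerPart l C))
    refine Eq.trans ?_ h.symm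
    refine FormalSum.eval_map _ (fockVector b)
      (fun p : Fin d × CellList n => (p.1, p.2.map fun s => (s.1 + C, s.2))) (fun p => ?_) _
    rw [LinearMap.restrictScalars_apply, fockVector, fockVector, map_smul, shift_single,
      shiftConfig_config]

theorem primrec_localStep {f : Fin n × CellList n → FormalSum (Fin d × CellList n)}
    (hf : Primrec f) : Primrec₂ (localStep f) := by
  have hC : Primrec fun p : (Cell × Fin n) × CellList n => p.1.1 := fst.comp fst
  refine list_map (hf.comp ((snd.comp fst).pair (primrec_innerPart.comp snd hC))) ?_
  refine ((fst.comp (fst.comp snd)).pair (list_append.comp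
    ((primrec_outerPart.comp snd hC).comp fst) (list_map (snd.comp (fst.comp snd)) ?_))).pair
    (snd.comp snd)
  exact (primrec_cell_add.comp (fst.comp snd) ((hC.comp fst).comp fst)).pair (snd.comp snd)

/-- Linear extension of a map given by formal combinations on configurations. -/
noncomputable def extend (f : CellList n → FormalSum (Fin d × CellList n))
    (l : FormalSum (Fin d × CellList n)) : FormalSum (Fin d × CellList n) :=
  FormalSum.bind (fun p => FormalSum.bind (fun q => scaledIndex b p.1 q.1 q.2) (f p.2)) l

theorem eval_extend (X : Module.End K (Fock K n))
    (f : CellList n → FormalSum (Fin d × CellList n))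
    (hf : ∀ l, FormalSum.eval (fockVector b) (f l) = X (Finsupp.single (config l) 1))
    (l : FormalSum (Fin d × CellList n)) :
    FormalSum.eval (fockVector b) (extend b f l) = X (FormalSum.eval (fockVector b) l) := by
  refine FormalSum.eval_bind (fockVector b) (fockVector b) (X.restrictScalars ℚ) _
    (fun p => ?_) l
  refine (FormalSum.eval_bind (fockVector b) (fockVector b) (smulBilin K (Fock K n) (b p.1)) _
    (fun q => ?_) _).trans ?_
  · exact (eval_scaledIndex b (fun l => (Finsupp.single (config l) 1 : Fock K n)) _ _ _).trans
      (mul_smul _ _ _)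
  · rw [hf]
    exact (X.map_smul _ _).symm

omit [NeZero n] in
theorem primrec_extend {α : Type} [Primcodable α]
    {f : α → CellList n → FormalSum (Fin d × CellList n)} (hf : Primrec₂ f)
    {l : α → FormalSum (Fin d × CellList n)} (hl : Primrec l) :
    Primrec fun a => extend b (f a) (l a) := by
  refine FormalSum.primrec_bind (f := fun a (p : Fin d × CellList n) =>
    FormalSum.bind (fun q => scaledIndex b p.1 q.1 q.2) (f a p.2)) ?_ hl
  refine FormalSum.primrec_bind (f := fun (a : α × (Fin d × CellList n)) q =>
    scaledIndex b a.2.1 q.1 q.2) ?_ (hf.comp fst (snd.comp snd))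
  exact primrec_scaledIndex b (fst.comp (snd.comp fst)) (fst.comp snd) (snd.comp snd)

theorem exists_primrec_op : ∃ f : FormalSum (Fin d × CellList n) → FormalSum (Fin d × CellList n),
    Primrec f ∧ ∀ l, FormalSum.eval (fockVector b) (f l) =
      U.op (FormalSum.eval (fockVector b) l) := by
  obtain ⟨f, hf, hfe⟩ := U.exists_localTable b
  -- The quiescent configuration need not be fixed by the evolution; a representative of its image
  -- is a constant of the program.
  obtain ⟨g, hg⟩ := (isPresentation_fock (n := n) b).surjective (U.op (Finsupp.single 0 1))
  refine ⟨extend b fun l => l.foldr (fun t s => extend b (localStep f t) s) g, ?_, ?_⟩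
  · refine primrec_extend b (α := FormalSum (Fin d × CellList n)) (f := fun _ l =>
      l.foldr (fun t s => extend b (localStep f t) s) g) ?_ Primrec.id
    refine list_foldr (f := fun p : FormalSum (Fin d × CellList n) × CellList n => p.2)
      (g := fun _ => g) (h := fun _ q => extend b (localStep f q.1) q.2) snd (Primrec.const g) ?_
    exact primrec_extend b (f := fun (p : (FormalSum (Fin d × CellList n) × CellList n) ×
      (Cell × Fin n) × FormalSum (Fin d × CellList n)) => localStep f p.2.1)
      ((primrec_localStep hf).comp (fst.comp (snd.comp fst)) snd) (snd.comp snd)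
  · refine eval_extend b U.op _ fun l => ?_
    induction l with
    | nil => exact hg
    | cons t l ih =>
      rw [List.foldr_cons, U.op_single_config_cons, ← ih]
      exact eval_extend b _ _ (U.eval_localStep b hfe t) _

theorem computable_iterate (ψ : ℕ → Fock K n) (hψ : ∀ k, ψ (k + 1) = U.op (ψ k)) :
    Computable fun k => (isPresentation_fock (n := n) b).indexing.code (ψ k) := by
  obtain ⟨f, hf, hfe⟩ := U.exists_primrec_op b
  obtain ⟨s, hs⟩ := (isPresentation_fock (n := n) b).surjective (ψ 0)
  have h1 : Primrec fun k : ℕ => f^[k] s :=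
    Primrec.nat_iterate Primrec.id (Primrec.const s) (hf.comp₂ Primrec₂.right)
  refine ((isPresentation_fock (n := n) b).computable_code.comp h1.to_comp).of_eq fun k => ?_
  have h2 : FormalSum.eval (fockVector b) (f^[k] s) = ψ k := by
    induction k with
    | zero => exact hs
    | succ k ih => rw [Function.iterate_succ_apply', hfe, ih, hψ]
  rw [h2]
  rfl

end LocalUnitary

/-! ### From the physical hypotheses to a local unitary -/

theorem injective_of_fockInner {X : Fock K n →ₗ[K] Fock K n}
    (h : ∀ ψ φ, fockInner (X ψ) (X φ) = fockInner ψ φ) : Function.Injective X := by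
  rw [← LinearMap.ker_eq_bot, LinearMap.ker_eq_bot']
  intro ψ hψ
  refine eq_zero_of_re_fockInner_self ?_
  rw [← h, hψ, fockInner_zero_left, Complex.zero_re]

/-- The local unitary operator given by an evolution. -/
noncomputable def LocalUnitary.ofEvolution {G : ℝ → Fock K n →ₗ[K] Fock K n}
    (hs : HomogeneousSpace G) (hb : BoundedVelocity G) (hu : UnitaryEvolution G) (t : ℝ) :
    LocalUnitary K n where
  op := G t
  inv := (LinearEquiv.ofBijective (G t) ⟨injective_of_fockInner (hu t).2, (hu t).1⟩).symm
  op_mul_inv := LinearMap.ext fun ψ =>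
    (LinearEquiv.ofBijective (G t) ⟨injective_of_fockInner (hu t).2, (hu t).1⟩).apply_symm_apply ψ
  inv_mul_op := LinearMap.ext fun ψ =>
    (LinearEquiv.ofBijective (G t) ⟨injective_of_fockInner (hu t).2, (hu t).1⟩).symm_apply_apply ψ
  isometry := (hu t).2
  op_shift v ψ := LinearMap.congr_fun (hs t v) ψ
  bounded A ψ φ := hb A t ψ φ

end

end QuantumGandy

theorem theorem2 (K : IntermediateField ℚ ℂ) [FiniteDimensional ℚ K] (n : ℕ) [NeZero n] :
    ∃ (iK : Indexing K) (iS : Indexing (CellState K n)) (iH : Indexing (Fock K n)),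
      Admissible iK iS iH ∧
      ∀ (T : ℝ) (G : ℝ → Fock K n →ₗ[K] Fock K n) (ψ : ℝ → Fock K n),
        HomogeneousSpace G → HomogeneousTime G → BoundedVelocity G → UnitaryEvolution G →
        (∀ t : ℝ, ψ (t + T) = G t (ψ t)) →
        Computable fun k : ℕ => iH.code (ψ (k * T)) := by
  let b := Module.finBasis ℚ K
  refine ⟨_, _, _, admissible_indexings b, fun T G ψ hs ht hb hu hψ => ?_⟩
  -- By homogeneity of time the evolution from time `0` serves at every step.
  refine (LocalUnitary.ofEvolution hs hb hu 0).computable_iterate b (fun k => ψ (k * T))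
    fun k => ?_
  have : ((k + 1 : ℕ) : ℝ) * T = k * T + T := by push_cast; ring
  simp only [this, hψ]
  exact LinearMap.congr_fun (ht _ _) _
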